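/- Let $k$ be a number field, $v$ a place of $k$ (archimedean or not), $k_v$ the completion of $k$ at $v$, and $\mathbb{C}_v$ the completion of an algebraic closure of $k_v$. Let $|\cdot|_v$ be the normalized absolute value on $k_v$, given by the modulus of additive Haar measure (so $|x|_v=|x|^{[k_v:\mathbb{R}]}$ if $v$ is archimedean and $|x|_v=q_v^{-\mathrm{ord}_v(x)}$, with $q_v$ the order of the residue field, otherwise), extended to $\mathbb{C}_v$. Let $\mathrm{vol}_v$ be Haar measure on $k_v$: Lebesgue measure if $k_v\cong\mathbb{R}$ or $\mathbb{C}$, and normalized by $\mathrm{vol}_v(\mathcal{O}_v)=1$ if $v$ is nonarchimedean. Let $E_v\subset\mathbb{C}_v^2$ be a nonempty bounded set that is stable under the group $\mathrm{Gal}^c(\mathbb{C}_v/k_v)$ of continuous automorphisms of $\mathbb{C}_v$ over $k_v$ (acting coordinatewise). For $n\ge 2$ put $$d^0_n(E_v)=\sup_{z_1,\dots,z_n\in E_v}\Bigl(\prod_{i\ne j}|z_i\wedge z_j|_v\Bigr)^{\frac1{n(n-1)}},\qquad (z_0,z_1)\wedge(w_0,w_1)=z_0w_1-z_1w_0 ,$$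 and let $d^0_\infty(E_v)=\lim_{n\to\infty}d^0_n(E_v)$ be the homogeneous transfinite diameter. For $n\ge 0$ let $\Gamma^0_v(n)$ be the space of homogeneous polynomials of degree $n$ in $k_v[x,y]$, with the measure $\mathrm{vol}_v$ transported from $k_v^{n+1}$ by the basis of monomials, let $$\mathcal{F}^0_v(n)=\Bigl\{f\in\Gamma^0_v(n):\ \sup_{z\in E_v}|f(z)|_v\le 1\Bigr\},$$ and let the local homogeneous sectional capacity $S^0_\gamma(E_v,H)\in[0,\infty]$ be defined by $$-\log S^0_\gamma(E_v,H)=\lim_{n\to\infty}\frac{2!}{n^2}\log \mathrm{vol}_v(\mathcal{F}^0_v(n)),$$ with $\log\infty=\infty$ and $-\log 0=\infty$. Then both limits exist (the second one in $[-\infty,\infty]$), $d^0_\infty(E_v)$ is finite, and $$S^0_\gamma(E_v,H)=d^0_\infty(E_v).$$ -/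

import Mathlib

open Filter Topology MeasureTheory NumberField IsDedekindDomain
open scoped ENNReal

namespace HomCap

noncomputable section

/-! ### Homogeneous transfinite diameter and homogeneous sectional capacity

Here `K` is a field, `C` is a field extension of `K`, `abv : C → ℝ` is a (normalized) absolute
value on `C`, and `vol` is a measure on `K`. -/

section General

variable {C : Type*} [Field C]

/-- `z ∧ w = z₀ w₁ - z₁ w₀`. -/
def wedge (z w : C × C) : C := z.1 * w.2 - z.2 * w.1

/-- `d⁰ₙ(E)`, the supremum over `z₁, …, zₙ ∈ E` of `(∏_{i ≠ j} |zᵢ ∧ zⱼ|) ^ (1 / (n (n - 1)))`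
(meaningful for `n ≥ 2`). -/
def homDiameter (abv : C → ℝ) (E : Set (C × C)) (n : ℕ) : ℝ≥0∞ :=
  ⨆ z : Fin n → E,
    (∏ p : Fin n × Fin n with p.1 ≠ p.2,
      ENNReal.ofReal (abv (wedge (z p.1 : C × C) (z p.2 : C × C)))) ^
        (1 / ((n : ℝ) * ((n : ℝ) - 1)))

/-- The homogeneous transfinite diameter `d⁰_∞(E) = lim_n d⁰ₙ(E)`. -/
def homTransfiniteDiameter (abv : C → ℝ) (E : Set (C × C)) : ℝ≥0∞ :=
  limUnder atTop (homDiameter abv E)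

/-- The sup norm `‖f‖_E` of a polynomial in two variables over `K` on a subset of `C²`. -/
def supNorm {K : Type*} [Field K] [Algebra K C] (abv : C → ℝ) (E : Set (C × C))
    (f : MvPolynomial (Fin 2) K) : ℝ≥0∞ :=
  ⨆ z ∈ E, ENNReal.ofReal (abv (MvPolynomial.aeval ![z.1, z.2] f))

variable (K : Type*) [Field K] [Algebra K C]

/-- `𝓕⁰(n)`: the forms of degree `n` in `K[x, y]` with sup norm at most `1` on `E`. -/
def unitForms (abv : C → ℝ) (E : Set (C × C)) (n : ℕ) : Set (MvPolynomial (Fin 2) K) :=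
  {f | f.IsHomogeneous n ∧ supNorm abv E f ≤ 1}

variable {K}

/-- The binary form `∑ aᵢ x^(n-i) y^i` of degree `n` with coefficient vector `a`. -/
def binaryForm (n : ℕ) (a : Fin (n + 1) → K) : MvPolynomial (Fin 2) K :=
  ∑ i : Fin (n + 1),
    MvPolynomial.C (a i) * MvPolynomial.X 0 ^ (n - (i : ℕ)) * MvPolynomial.X 1 ^ (i : ℕ)

/-- The volume of a set of forms of degree `n`, in the coordinates given by the basis
of monomials. -/
def formVolume [MeasurableSpace K] (vol : Measure K) (n : ℕ)
    (F : Set (MvPolynomial (Fin 2) K)) : ℝ≥0∞ :=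
  Measure.pi (fun _ : Fin (n + 1) => vol) (binaryForm n ⁻¹' F)

/-- `(2! / n²) log vol(𝓕⁰(n))`, with the value `⊤` if the volume is infinite. -/
def logVolume [MeasurableSpace K] (vol : Measure K) (abv : C → ℝ) (E : Set (C × C)) (n : ℕ) :
    EReal :=
  ((2 / (n : ℝ) ^ 2 : ℝ) : EReal) * ENNReal.log (formVolume vol n (unitForms K abv E n))

/-- The homogeneous sectional capacity `S⁰_γ(E, H)`, given by
`- log S⁰_γ(E, H) = lim_n (2! / n²) log vol(𝓕⁰(n))`. -/
def homSectionalCapacity [MeasurableSpace K] (vol : Measure K) (abv : C → ℝ)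
    (E : Set (C × C)) : ℝ≥0∞ :=
  EReal.exp (-limUnder atTop (logVolume vol abv E))

end General

/-- `E ⊆ C²` is stable under the group of continuous automorphisms of `C` over `K`. -/
def GaloisStable (K : Type*) {C : Type*} [Field K] [Field C] [Algebra K C] [TopologicalSpace C]
    (E : Set (C × C)) : Prop :=
  ∀ σ : C ≃A[K] C, ∀ z ∈ E, (σ z.1, σ z.2) ∈ E

/-! ### Archimedean places

For an archimedean place `w`, the field `ℂ` is an algebraic closure of `k_w = w.Completion`,
which embeds isometrically in `ℂ`, and it is complete; so `ℂ_w = ℂ`. -/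

section Archimedean

variable {k : Type*} [Field k] (w : InfinitePlace k)

instance archAlgebra : Algebra w.Completion ℂ :=
  (InfinitePlace.Completion.extensionEmbedding w).toAlgebra

instance archMeasurableSpace : MeasurableSpace w.Completion := borel _

instance archBorelSpace : BorelSpace w.Completion := ⟨rfl⟩

/-- The normalized absolute value `|z|_w = |z| ^ [k_w : ℝ]` on `ℂ_w = ℂ`. -/
def archAbs (z : ℂ) : ℝ := ‖z‖ ^ w.mult

/-- Lebesgue measure on `k_w ≅ ℝ` or `k_w ≅ ℂ`. -/
def archVol : Measure w.Completion :=
  open Classical in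
  if h : w.IsReal then
    Measure.map (InfinitePlace.Completion.isometryEquivRealOfIsReal h).symm volume
  else
    Measure.map (InfinitePlace.Completion.isometryEquivComplexOfIsComplex
      (InfinitePlace.not_isReal_iff_isComplex.mp h)).symm volume

end Archimedean

/-! ### Nonarchimedean places

Mathlib's norm on `k_v = v.adicCompletion k` is the normalized one, `‖x‖ = q_v ^ (-ord_v x)`. -/

section Nonarchimedean

variable {k : Type*} [Field k] [NumberField k] (v : HeightOneSpectrum (𝓞 k))

instance adicNontriviallyNormedField : NontriviallyNormedField (v.adicCompletion k) where
  non_trivial := (Valued.toNontriviallyNormedField (v.adicCompletion k) _).non_trivial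

instance adicUltrametric : IsUltrametricDist (v.adicCompletion k) :=
  inferInstanceAs (@IsUltrametricDist _ (Valued.toNormedField (v.adicCompletion k) _).toDist)

open scoped Valued in
theorem adic_finite_residueField : Finite 𝓀[v.adicCompletion k] := by
  have : Finite (𝓞 k ⧸ v.asIdeal) := v.asIdeal.finiteQuotientOfFreeOfNeBot v.ne_bot
  let f : 𝓞 k →+* 𝓀[v.adicCompletion k] :=
    (IsLocalRing.residue 𝒪[v.adicCompletion k]).comp
      (algebraMap (𝓞 k) (v.adicCompletionIntegers k))
  have hlt : ∀ x : 𝒪[v.adicCompletion k],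
      Valued.v (x : v.adicCompletion k) < 1 → IsLocalRing.residue 𝒪[v.adicCompletion k] x = 0 := by
    intro x hx
    rw [IsLocalRing.residue_eq_zero_iff]
    exact (Valuation.mem_maximalIdeal_iff _ _).2 hx
  have hker : ∀ r ∈ v.asIdeal, f r = 0 := fun r hr =>
    hlt _ (((v.valuedAdicCompletion_eq_valuation (K := k) r).trans_lt
      ((v.valuation_lt_one_iff_mem (K := k) r).2 hr)))
  have hsurj : Function.Surjective f := by
    intro y
    obtain ⟨x, rfl⟩ := IsLocalRing.residue_surjective y
    obtain ⟨c, hc⟩ := (v.denseRange_algebraMap k).exists_mem_open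
      (Metric.isOpen_ball (x := (x : v.adicCompletion k)) (ε := 1)) ⟨x, by simp⟩
    have hc' : Valued.v (algebraMap k (v.adicCompletion k) c - x) < 1 :=
      Valued.toNormedField.norm_lt_one_iff.1 (by simpa [dist_eq_norm] using hc)
    have hc1 : v.valuation k c ≤ 1 := by
      rw [← v.valuedAdicCompletion_eq_valuation' (K := k) c]
      have := Valued.v.map_add (algebraMap k (v.adicCompletion k) c - x) x
      rw [sub_add_cancel] at this
      exact this.trans (max_le hc'.le x.2)
    obtain ⟨r, hr⟩ := v.exists_valuation_sub_lt_of_integer (K := k) hc1 1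
    refine ⟨r, ?_⟩
    rw [← sub_eq_zero]
    change IsLocalRing.residue 𝒪[v.adicCompletion k] _ - _ = 0
    rw [← map_sub]
    refine hlt _ ?_
    rw [Units.val_one, ← v.valuedAdicCompletion_eq_valuation' (K := k)] at hr
    have := Valued.v.map_add (algebraMap k (v.adicCompletion k) (algebraMap (𝓞 k) k r - c))
      (algebraMap k (v.adicCompletion k) c - x)
    rw [map_sub, sub_add_sub_cancel] at this
    refine this.trans_lt (max_lt ?_ hc')
    rw [← map_sub]
    exact hr
  exact Finite.of_surjective (Ideal.Quotient.lift v.asIdeal f hker)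
    (Ideal.Quotient.lift_surjective_of_surjective _ _ hsurj)

instance adicProperSpace : ProperSpace (v.adicCompletion k) :=
  Valued.integer.properSpace_iff_completeSpace_and_isDiscreteValuationRing_integer_and_finite_residueField.2
    ⟨inferInstance, inferInstanceAs (IsDiscreteValuationRing (v.adicCompletionIntegers k)),
      adic_finite_residueField v⟩

instance adicMeasurableSpace : MeasurableSpace (v.adicCompletion k) := borel _

instance adicBorelSpace : BorelSpace (v.adicCompletion k) := ⟨rfl⟩

/-- Haar measure on `k_v`, normalized so that the ring of integers has volume `1`. -/
def adicVol : Measure (v.adicCompletion k) :=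
  Measure.addHaarMeasure
    ⟨⟨Metric.closedBall 0 1, isCompact_closedBall 0 1⟩,
      ⟨0, Metric.ball_subset_interior_closedBall (Metric.mem_ball_self one_pos)⟩⟩

/-- A fixed algebraic closure of `k_v`. -/
abbrev AdicAlgCl : Type _ := AlgebraicClosure (v.adicCompletion k)

/-- The unique extension of the absolute value of `k_v` to its algebraic closure. -/
instance adicAlgClNormedField : NormedField (AdicAlgCl v) :=
  spectralNorm.normedField (v.adicCompletion k) (AdicAlgCl v)

instance adicAlgClNormedAlgebra : NormedAlgebra (v.adicCompletion k) (AdicAlgCl v) :=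
  spectralNorm.normedAlgebra _ _

/-- `ℂ_v`, the completion of the algebraic closure of `k_v`. -/
abbrev AdicComplex : Type _ := UniformSpace.Completion (AdicAlgCl v)

/-- The normalized absolute value on `ℂ_v`. -/
def adicAbs (z : AdicComplex v) : ℝ := ‖z‖

end Nonarchimedean

end

end HomCap

namespace HomCap

noncomputable section

/-! Both quantities are governed by Chebyshev constants. Dehomogenize a binary form of degree `n` to
a polynomial of degree at most `n`, and let `T_l` be the infimum of the sup norms on `E` of the
degree `n` forms attached to monic polynomials of degree `l`.

On the diameter side, the product of the wedges is the square of a projective Vandermonde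
determinant. Its maximum `V_n` over `E` is at least the product of the `T_l` over `C` (expand along
the last row, `prod_chebyshev_le_maxDet`) and at most `(n+1)!` times the product of the `T_l` over
`K` (change to a basis of monic polynomials and use the Leibniz formula,
`maxDet_le_prod_chebyshev`).

On the volume side, Fubini in the coefficients shows that the unit ball of forms is essentially a
box with sides `1/T_l`. Hence its volume times `V_n ^ δ` is at most `exp(O(n log n))`
(`formVolume_mul_maxDet_le`), and monic polynomials over `K` of small norm give a lower bound
(`le_formVolume`). Errors of size `exp(O(n log n))` vanish after dividing logarithms by `n²`.

Two points remain. To pass from `C` to `K`, a monic polynomial is replaced by a product of Galois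
conjugates, each with the same norm bound because `E` is stable (`Descends`). To obtain limits,
polynomials found for a single `m` are turned, by taking powers and multiplying by a power of `X`,
into monic polynomials over `K` of every degree `l ≤ n` for all large `n`, at a cost that tends to
zero with `1/m` (`Descends.eventually_exists_monic`). This is a Fekete argument: it bounds the
limsup of the diameters by their liminf, and yields the lower bound for the volumes. -/

theorem enorm_finset_prod {F ι : Type*} [NormedField F] (s : Finset ι) (f : ι → F) :
    ‖∏ i ∈ s, f i‖ₑ = ∏ i ∈ s, ‖f i‖ₑ := by
  classical
  induction s using Finset.induction_on with
  | empty => simp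
  | insert a s ha ih => rw [Finset.prod_insert ha, Finset.prod_insert ha, enorm_mul, ih]

/-- Adding one small `ε` to every factor moves the product continuously. The new factors are
positive reals even where `T i = 0`, so they have logarithms, and they lie strictly above infima
that need not be attained. -/
theorem exists_pos_gt_prod_lt {ι : Type*} (s : Finset ι) {T : ι → ℝ≥0∞} (hT : ∀ i, T i ≠ ∞)
    {x : ℝ≥0∞} (hx : ∏ i ∈ s, T i < x) :
    ∃ t : ι → ℝ, (∀ i, 0 < t i) ∧ (∀ i, T i < ENNReal.ofReal (t i)) ∧
      ∏ i ∈ s, ENNReal.ofReal (t i) < x := by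
  have h0 : ENNReal.ofReal (∏ i ∈ s, ((T i).toReal + 0)) < x := by
    rw [ENNReal.ofReal_prod_of_nonneg (fun i _ => by simp)]
    simpa [ENNReal.ofReal_toReal (hT _)] using hx
  have hc : Continuous fun ε : ℝ => ENNReal.ofReal (∏ i ∈ s, ((T i).toReal + ε)) :=
    ENNReal.continuous_ofReal.comp (by fun_prop)
  have h1 : ∀ᶠ ε in 𝓝[>] (0 : ℝ), ENNReal.ofReal (∏ i ∈ s, ((T i).toReal + ε)) < x :=
    (hc.continuousAt.eventually (gt_mem_nhds h0)).filter_mono nhdsWithin_le_nhds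
  obtain ⟨ε, hε, hpos⟩ := (h1.and self_mem_nhdsWithin).exists
  replace hpos : 0 < ε := hpos
  have hp : ∀ i, 0 < (T i).toReal + ε := fun i =>
    add_pos_of_nonneg_of_pos ENNReal.toReal_nonneg hpos
  refine ⟨fun i => (T i).toReal + ε, hp, fun i => ?_, ?_⟩
  · rw [ENNReal.lt_ofReal_iff_toReal_lt (hT i)]
    linarith
  · rwa [← ENNReal.ofReal_prod_of_nonneg fun i _ => (hp i).le]

/-! ### Binary forms attached to polynomials, and their sup norms on `E` -/

section Forms

open Polynomial

variable {C : Type*} [NormedField C]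

/-- The value at `z` of the binary form `∑ pᵢ x^(n-i) y^i` of degree `n` attached to `p`. -/
def formEval (n : ℕ) (p : C[X]) (z : C × C) : C :=
  MvPolynomial.eval ![z.2, z.1] (p.homogenize n)

/-- The sup norm on `E` of the binary form of degree `n` attached to `p`. -/
def formNorm (E : Set (C × C)) (n : ℕ) (p : C[X]) : ℝ≥0∞ :=
  ⨆ z ∈ E, ‖formEval n p z‖ₑ

/-- Homogenization gives the polynomial variable index `0` and the homogenizing variable index `1`.
This is why `formEval` evaluates at the swapped pair. -/
theorem formEval_eq_sum (n : ℕ) (p : C[X]) (z : C × C) :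
    formEval n p z = ∑ i : Fin (n + 1), p.coeff i * z.1 ^ (n - (i : ℕ)) * z.2 ^ (i : ℕ) := by
  rw [formEval, homogenize, Finset.Nat.sum_antidiagonal_eq_sum_range_succ_mk,
    ← Fin.sum_univ_eq_sum_range
      (fun i => MvPolynomial.monomial (fun₀ | 0 => i | 1 => n - i) (p.coeff i)), map_sum]
  refine Finset.sum_congr rfl fun i _ => ?_
  simp only [MvPolynomial.eval_monomial]
  rw [Finsupp.prod_fintype _ _ (by simp)]
  simp [Fin.prod_univ_two]
  ring

theorem formEval_mul {n m : ℕ} {p q : C[X]} (hp : p.natDegree ≤ n) (hq : q.natDegree ≤ m)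
    (z : C × C) : formEval (n + m) (p * q) z = formEval n p z * formEval m q z := by
  simp [formEval, homogenize_mul _ _ hp hq]

theorem formEval_C_mul (n : ℕ) (a : C) (p : C[X]) (z : C × C) :
    formEval n (Polynomial.C a * p) z = a * formEval n p z := by
  simp [formEval]

theorem formEval_sum {ι : Type*} (s : Finset ι) (n : ℕ) (p : ι → C[X]) (z : C × C) :
    formEval n (∑ i ∈ s, p i) z = ∑ i ∈ s, formEval n (p i) z := by
  simp [formEval]

theorem formEval_sub (n : ℕ) (p q : C[X]) (z : C × C) :
    formEval n (p - q) z = formEval n p z - formEval n q z := by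
  simp [formEval]

theorem formEval_X_pow {n i : ℕ} (h : i ≤ n) (z : C × C) :
    formEval n (X ^ i) z = z.1 ^ (n - i) * z.2 ^ i := by
  simp [formEval, homogenize_X_pow h, mul_comm]

theorem enorm_formEval_le (E : Set (C × C)) (n : ℕ) (p : C[X]) {z : C × C} (hz : z ∈ E) :
    ‖formEval n p z‖ₑ ≤ formNorm E n p :=
  le_iSup₂ (f := fun z (_ : z ∈ E) => ‖formEval n p z‖ₑ) z hz

theorem formNorm_mul_le (E : Set (C × C)) {n m : ℕ} {p q : C[X]} (hp : p.natDegree ≤ n)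
    (hq : q.natDegree ≤ m) :
    formNorm E (n + m) (p * q) ≤ formNorm E n p * formNorm E m q := by
  refine iSup₂_le fun z hz => ?_
  rw [formEval_mul hp hq, enorm_mul]
  exact mul_le_mul' (enorm_formEval_le E n p hz) (enorm_formEval_le E m q hz)

theorem formNorm_one_le (E : Set (C × C)) : formNorm E 0 1 ≤ 1 := by
  refine iSup₂_le fun z _ => ?_
  simp [formEval]

theorem formNorm_pow_le (E : Set (C × C)) {n : ℕ} {p : C[X]} (hp : p.natDegree ≤ n) (k : ℕ) :
    formNorm E (n * k) (p ^ k) ≤ formNorm E n p ^ k := by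
  induction k with
  | zero => simpa using formNorm_one_le E
  | succ k ih =>
    rw [pow_succ, pow_succ, Nat.mul_succ]
    refine (formNorm_mul_le E ?_ hp).trans (mul_le_mul_left ih _)
    exact (natDegree_pow_le).trans (by rw [mul_comm]; exact Nat.mul_le_mul_right k hp)

theorem formNorm_C_mul (E : Set (C × C)) (n : ℕ) (a : C) (p : C[X]) :
    formNorm E n (Polynomial.C a * p) = ‖a‖ₑ * formNorm E n p := by
  simp [formNorm, formEval_C_mul, ENNReal.mul_iSup]

theorem formNorm_sub_le (E : Set (C × C)) (n : ℕ) (p q : C[X]) :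
    formNorm E n (p - q) ≤ formNorm E n p + formNorm E n q := by
  refine iSup₂_le fun z hz => ?_
  rw [formEval_sub]
  exact enorm_sub_le.trans
    (add_le_add (enorm_formEval_le E n p hz) (enorm_formEval_le E n q hz))

theorem formNorm_add_le (E : Set (C × C)) (n : ℕ) (p q : C[X]) :
    formNorm E n (p + q) ≤ formNorm E n p + formNorm E n q := by
  refine iSup₂_le fun z hz => ?_
  have : formEval n (p + q) z = formEval n p z + formEval n q z := by simp [formEval]
  rw [this]
  exact (enorm_add_le _ _).trans
    (add_le_add (enorm_formEval_le E n p hz) (enorm_formEval_le E n q hz))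

theorem formNorm_X_pow_le {E : Set (C × C)} {R : ℝ≥0∞}
    (hE : ∀ z ∈ E, ‖z.1‖ₑ ≤ R ∧ ‖z.2‖ₑ ≤ R) {i n : ℕ} (h : i ≤ n) :
    formNorm E n (X ^ i) ≤ R ^ n := by
  refine iSup₂_le fun z hz => ?_
  rw [formEval_X_pow h, enorm_mul, enorm_pow, enorm_pow]
  calc ‖z.1‖ₑ ^ (n - i) * ‖z.2‖ₑ ^ i ≤ R ^ (n - i) * R ^ i :=
        mul_le_mul' (pow_le_pow_left' (hE z hz).1 _) (pow_le_pow_left' (hE z hz).2 _)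
    _ = R ^ n := by rw [← pow_add, Nat.sub_add_cancel h]

theorem formNorm_le_sum_coeff {E : Set (C × C)} {R : ℝ≥0∞}
    (hE : ∀ z ∈ E, ‖z.1‖ₑ ≤ R ∧ ‖z.2‖ₑ ≤ R) (n : ℕ) (p : C[X]) :
    formNorm E n p ≤ (∑ i : Fin (n + 1), ‖p.coeff i‖ₑ) * R ^ n := by
  refine iSup₂_le fun z hz => ?_
  rw [formEval_eq_sum, Finset.sum_mul]
  refine (enorm_sum_le _ _).trans (Finset.sum_le_sum fun i _ => ?_)
  have h := Nat.lt_succ_iff.1 i.2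
  rw [mul_assoc, enorm_mul, ← formEval_X_pow h]
  gcongr
  exact (enorm_formEval_le E n _ hz).trans (formNorm_X_pow_le hE h)

theorem formNorm_ne_top {E : Set (C × C)} {R : ℝ≥0∞}
    (hE : ∀ z ∈ E, ‖z.1‖ₑ ≤ R ∧ ‖z.2‖ₑ ≤ R) (hR : R ≠ ∞) (n : ℕ) (p : C[X]) :
    formNorm E n p ≠ ∞ :=
  ne_top_of_le_ne_top (by simp [ENNReal.mul_eq_top, ENNReal.sum_eq_top, hR])
    (formNorm_le_sum_coeff hE n p)

/-! ### Vandermonde determinants and Chebyshev constants -/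

/-- The determinant of the evaluations of the first `l` monomials of degree `n` at `l` points. -/
def formDet (n l : ℕ) (z : Fin l → C × C) : C :=
  (Matrix.of fun i j : Fin l => formEval n (X ^ (j : ℕ)) (z i)).det

/-- The supremum of `formDet n l` over the tuples of `l` points of `E`. -/
def maxDet (E : Set (C × C)) (n l : ℕ) : ℝ≥0∞ :=
  ⨆ z : Fin l → E, ‖formDet n l (fun i => (z i : C × C))‖ₑ

/-- The Chebyshev constant: the infimum of the norms of the forms of degree `n` attached to the
monic polynomials of degree `l` over `K`. -/
def chebyshev (K : Type*) [Field K] [Algebra K C] (E : Set (C × C)) (n l : ℕ) : ℝ≥0∞ :=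
  ⨅ p : {p : K[X] // p.Monic ∧ p.natDegree = l}, formNorm E n (p.1.map (algebraMap K C))

theorem chebyshev_le {K : Type*} [Field K] [Algebra K C] (E : Set (C × C)) (n : ℕ) {p : K[X]}
    (hp : p.Monic) :
    chebyshev K E n p.natDegree ≤ formNorm E n (p.map (algebraMap K C)) :=
  iInf_le (fun q : {q : K[X] // q.Monic ∧ q.natDegree = p.natDegree} =>
    formNorm E n (q.1.map (algebraMap K C))) ⟨p, hp, rfl⟩

theorem chebyshev_self_le (E : Set (C × C)) (n : ℕ) {p : C[X]} (hp : p.Monic) :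
    chebyshev C E n p.natDegree ≤ formNorm E n p := by
  simpa using chebyshev_le (K := C) E n hp

theorem chebyshev_ne_top {K : Type*} [Field K] [Algebra K C] {E : Set (C × C)} {R : ℝ≥0∞}
    (hE : ∀ z ∈ E, ‖z.1‖ₑ ≤ R ∧ ‖z.2‖ₑ ≤ R) (hR : R ≠ ∞) (n l : ℕ) :
    chebyshev K E n l ≠ ∞ := by
  have := chebyshev_le (C := C) E n (monic_X_pow (R := K) l)
  rw [natDegree_X_pow] at this
  exact ne_top_of_le_ne_top (formNorm_ne_top hE hR _ _) this

/-- Expansion along the last row: as a function of the last point the determinant is a form, whose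
coefficients are the signed minors. The top one is the determinant of the first `l` points, with
sign `+`. -/
theorem formDet_snoc (n l : ℕ) (z : Fin l → C × C) :
    ∃ p : C[X], p.natDegree ≤ l ∧ p.coeff l = formDet n l z ∧
      ∀ w, formEval n p w = formDet n (l + 1) (Fin.snoc z w : Fin (l + 1) → C × C) := by
  set c : Fin (l + 1) → C := fun j => (-1) ^ (l + (j : ℕ)) *
    (Matrix.of fun i k : Fin l => formEval n (X ^ ((j.succAbove k : Fin (l + 1)) : ℕ)) (z i)).det
    with hc
  refine ⟨∑ j : Fin (l + 1), Polynomial.C (c j) * X ^ (j : ℕ), ?_, ?_, fun w => ?_⟩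
  · exact natDegree_sum_le_of_forall_le _ _ fun j _ =>
      (natDegree_C_mul_X_pow_le _ _).trans (Nat.lt_succ_iff.1 j.2)
  · rw [finsetSum_coeff, Finset.sum_eq_single (Fin.last l)]
    · simp [hc, formDet, ← two_mul]
    · intro j _ hj
      rw [coeff_C_mul_X_pow, if_neg]
      intro h
      exact hj (Fin.ext h.symm)
    · simp
  · rw [formEval_sum, formDet, Matrix.det_succ_row _ (Fin.last l)]
    refine Finset.sum_congr rfl fun j _ => ?_
    rw [formEval_C_mul]
    simp only [Matrix.of_apply, Fin.snoc_last, hc, Fin.val_last]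
    have : (Matrix.of fun i j : Fin (l + 1) => formEval n (X ^ (j : ℕ))
        ((Fin.snoc z w : Fin (l + 1) → C × C) i)).submatrix (Fin.last l).succAbove j.succAbove =
        Matrix.of fun i k : Fin l =>
          formEval n (X ^ ((j.succAbove k : Fin (l + 1)) : ℕ)) (z i) := by
      ext i k
      simp
    rw [this]
    ring

/-- Dividing the last-row form by its top coefficient `d` makes it monic of degree `l`, so its norm
is at least `|d|` times the Chebyshev constant; its values on `E` are determinants of size `l + 1`.
-/
theorem chebyshev_mul_maxDet_le (E : Set (C × C)) (n l : ℕ) :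
    chebyshev C E n l * maxDet E n l ≤ maxDet E n (l + 1) := by
  rw [maxDet, ENNReal.mul_iSup]
  refine iSup_le fun z => ?_
  obtain ⟨p, hp, hpl, hpe⟩ := formDet_snoc n l (fun i => (z i : C × C))
  set d := formDet n l (fun i => (z i : C × C)) with hd
  rcases eq_or_ne d 0 with h0 | h0
  · simp [h0]
  have hdeg : p.natDegree = l := le_antisymm hp (le_natDegree_of_ne_zero (by rwa [hpl]))
  have hlead : p.leadingCoeff = d := by rw [leadingCoeff, hdeg, hpl]
  have hmon : (Polynomial.C d⁻¹ * p).Monic := by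
    rw [Monic, leadingCoeff_mul, leadingCoeff_C, hlead, inv_mul_cancel₀ h0]
  have hnat : (Polynomial.C d⁻¹ * p).natDegree = l := by
    rw [natDegree_C_mul (inv_ne_zero h0), hdeg]
  have h1 := chebyshev_self_le E n hmon
  rw [hnat, formNorm_C_mul] at h1
  have h2 : formNorm E n p ≤ maxDet E n (l + 1) := by
    refine iSup₂_le fun w hw => ?_
    rw [hpe]
    refine le_trans (le_of_eq ?_)
      (le_iSup (fun z : Fin (l + 1) → E => ‖formDet n (l + 1) (fun i => (z i : C × C))‖ₑ)
        (Fin.snoc z ⟨w, hw⟩))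
    congr 2
    funext i
    refine Fin.lastCases ?_ (fun i => ?_) i <;> simp
  calc chebyshev C E n l * ‖d‖ₑ ≤ ‖d⁻¹‖ₑ * formNorm E n p * ‖d‖ₑ := by gcongr
    _ = (‖d⁻¹‖ₑ * ‖d‖ₑ) * formNorm E n p := by ring
    _ = formNorm E n p := by rw [← enorm_mul, inv_mul_cancel₀ h0, enorm_one, one_mul]
    _ ≤ _ := h2

theorem prod_chebyshev_le_maxDet {E : Set (C × C)} (hne : E.Nonempty) (n l : ℕ) :
    ∏ j ∈ Finset.range l, chebyshev C E n j ≤ maxDet E n l := by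
  induction l with
  | zero =>
    obtain ⟨z, hz⟩ := hne
    refine le_trans ?_ (le_iSup _ (fun _ => ⟨z, hz⟩))
    simp [formDet]
  | succ l ih =>
    rw [Finset.prod_range_succ, mul_comm]
    exact (mul_le_mul_right ih _).trans (chebyshev_mul_maxDet_le E n l)

/-- The change of basis from monomials to monic polynomials of degrees `0, …, n` is upper triangular
with ones on the diagonal. -/
theorem formDet_eq_det_monic (n : ℕ) (z : Fin (n + 1) → C × C) {p : Fin (n + 1) → C[X]}
    (hp : ∀ j, (p j).Monic) (hd : ∀ j, (p j).natDegree = j) :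
    formDet n (n + 1) z = (Matrix.of fun i j => formEval n (p j) (z i)).det := by
  have : (Matrix.of fun i j => formEval n (p j) (z i)) =
      (Matrix.of fun i j : Fin (n + 1) => formEval n (X ^ (j : ℕ)) (z i)) *
        (Matrix.of fun k j : Fin (n + 1) => (p j).coeff k) := by
    ext i j
    rw [Matrix.mul_apply, Matrix.of_apply, formEval_eq_sum]
    refine Finset.sum_congr rfl fun k _ => ?_
    rw [Matrix.of_apply, Matrix.of_apply, formEval_X_pow (Nat.lt_succ_iff.1 k.2)]
    ring
  rw [this, Matrix.det_mul, formDet, 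
    Matrix.det_of_isUpperTriangular (M := Matrix.of fun k j : Fin (n + 1) => (p j).coeff k)]
  · have : ∀ j : Fin (n + 1), (p j).coeff j = 1 := fun j => by
      have := (hp j).coeff_natDegree
      rwa [hd] at this
    simp [this]
  · intro i j hij
    exact coeff_eq_zero_of_natDegree_lt (by rw [hd]; exact hij)

/-- Each of the `(n+1)!` terms of the Leibniz formula contains exactly one value of each form. -/
theorem maxDet_le_prod_formNorm (E : Set (C × C)) (n : ℕ) {p : Fin (n + 1) → C[X]}
    (hp : ∀ j, (p j).Monic) (hd : ∀ j, (p j).natDegree = j) :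
    maxDet E n (n + 1) ≤ (n + 1).factorial * ∏ j, formNorm E n (p j) := by
  refine iSup_le fun z => ?_
  rw [formDet_eq_det_monic n _ hp hd, Matrix.det_apply]
  refine (enorm_sum_le _ _).trans ?_
  have : ∀ σ ∈ (Finset.univ : Finset (Equiv.Perm (Fin (n + 1)))),
      ‖Equiv.Perm.sign σ • ∏ i, (Matrix.of fun i j => formEval n (p j) (z i : C × C)) (σ i) i‖ₑ ≤
        ∏ j, formNorm E n (p j) := by
    intro σ _
    have h1 : ∀ x : C, ‖Equiv.Perm.sign σ • x‖ₑ = ‖x‖ₑ := by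
      intro x
      rcases Int.units_eq_one_or (Equiv.Perm.sign σ) with h | h <;> simp [h]
    rw [h1, enorm_finset_prod]
    exact Finset.prod_le_prod' fun j _ => enorm_formEval_le E n (p j) (z (σ j)).2
  refine (Finset.sum_le_card_nsmul _ _ _ this).trans ?_
  simp [Finset.card_univ, Fintype.card_perm]

theorem maxDet_le_prod_chebyshev {K : Type*} [Field K] [Algebra K C] {E : Set (C × C)}
    {R : ℝ≥0∞} (hE : ∀ z ∈ E, ‖z.1‖ₑ ≤ R ∧ ‖z.2‖ₑ ≤ R) (hR : R ≠ ∞) (n : ℕ) :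
    maxDet E n (n + 1) ≤ (n + 1).factorial * ∏ j : Fin (n + 1), chebyshev K E n j := by
  by_contra! h
  have hf : ((n + 1).factorial : ℝ≥0∞) ≠ 0 := by exact_mod_cast (Nat.factorial_pos _).ne'
  have hf' : ((n + 1).factorial : ℝ≥0∞) ≠ ∞ := ENNReal.natCast_ne_top _
  rw [mul_comm, ← ENNReal.lt_div_iff_mul_lt (Or.inl hf) (Or.inl hf')] at h
  obtain ⟨t, -, htT, ht⟩ := exists_pos_gt_prod_lt _ (fun j => chebyshev_ne_top hE hR n _) h
  have hex : ∀ j : Fin (n + 1), ∃ p : K[X], p.Monic ∧ p.natDegree = j ∧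
      formNorm E n (p.map (algebraMap K C)) < ENNReal.ofReal (t j) := by
    intro j
    obtain ⟨p, hp⟩ := iInf_lt_iff.1 (htT j)
    exact ⟨p.1, p.2.1, p.2.2, hp⟩
  choose p hpm hpd hpn using hex
  have := maxDet_le_prod_formNorm E n (p := fun j => (p j).map (algebraMap K C))
    (fun j => (hpm j).map _) (fun j => by rw [natDegree_map, hpd])
  refine absurd (this.trans (mul_le_mul_right
    (Finset.prod_le_prod' fun j _ => (hpn j).le) _)) (not_le.2 ?_)
  rwa [mul_comm, ← ENNReal.lt_div_iff_mul_lt (Or.inl hf) (Or.inl hf')]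

/-- The matrix is a projective Vandermonde matrix, with determinant the product of the wedges over
`i < j` (for this order of the coordinates). Ordered pairs `i ≠ j` count each wedge twice, hence the
square. -/
theorem enorm_formDet (n : ℕ) (z : Fin (n + 1) → C × C) :
    ∏ p : Fin (n + 1) × Fin (n + 1) with p.1 ≠ p.2, ‖wedge (z p.1) (z p.2)‖ₑ =
      ‖formDet n (n + 1) z‖ₑ ^ 2 := by
  have h1 : formDet n (n + 1) z = ∏ p : Fin (n + 1) × Fin (n + 1) with p.1 < p.2,
      wedge (z p.1) (z p.2) := by
    have : (Matrix.of fun i j : Fin (n + 1) => formEval n (X ^ (j : ℕ)) (z i)) =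
        Matrix.projVandermonde (fun i => (z i).2) (fun i => (z i).1) := by
      ext i j
      rw [Matrix.of_apply, formEval_X_pow (Nat.lt_succ_iff.1 j.2), Matrix.projVandermonde_apply,
        mul_comm, Fin.val_rev]
      congr 2
      omega
    rw [formDet, this, Matrix.det_projVandermonde, Finset.prod_filter,
      ← Finset.univ_product_univ, Finset.prod_product]
    refine Finset.prod_congr rfl fun i _ => ?_
    rw [← Finset.prod_filter]
    refine Finset.prod_congr (by ext; simp) fun j _ => ?_
    simp only [wedge]
    ring
  have h2 : ∏ p : Fin (n + 1) × Fin (n + 1) with p.2 < p.1, ‖wedge (z p.1) (z p.2)‖ₑ =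
      ∏ p : Fin (n + 1) × Fin (n + 1) with p.1 < p.2, ‖wedge (z p.1) (z p.2)‖ₑ := by
    refine Finset.prod_bij (fun p _ => p.swap) (by simp)
      (fun p _ q _ h => Prod.swap_injective h) ?_ ?_
    · intro p hp
      exact ⟨p.swap, by simpa using hp, by simp⟩
    · intro p _
      rw [← enorm_neg]
      congr 1
      simp only [wedge, Prod.fst_swap, Prod.snd_swap]
      ring
  have h3 : (Finset.univ.filter fun p : Fin (n + 1) × Fin (n + 1) => p.1 ≠ p.2) =
      (Finset.univ.filter fun p : Fin (n + 1) × Fin (n + 1) => p.1 < p.2) ∪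
        (Finset.univ.filter fun p : Fin (n + 1) × Fin (n + 1) => p.2 < p.1) := by
    ext p
    simp only [Finset.mem_filter, Finset.mem_univ, true_and, Finset.mem_union]
    exact ne_iff_lt_or_gt
  rw [h3, Finset.prod_union, h2, h1, enorm_finset_prod, sq]
  rw [Finset.disjoint_filter]
  intro p _ h
  exact h.not_gt

end Forms

/-! ### Volume estimates by slicing from the last coordinate down -/

section Fubini

theorem measurable_snoc {K : Type*} [MeasurableSpace K] {N : ℕ} (x : K) :
    Measurable fun b : Fin N → K => (Fin.snoc b x : Fin (N + 1) → K) := by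
  refine measurable_pi_iff.2 fun i => ?_
  refine Fin.lastCases ?_ (fun i => ?_) i
  · simp
  · simpa using measurable_pi_apply i

theorem pi_eq_lintegral_snoc {K : Type*} [MeasurableSpace K] (vol : Measure K) [SigmaFinite vol]
    {N : ℕ} {S : Set (Fin (N + 1) → K)}
    (hS : MeasurableSet S) :
    Measure.pi (fun _ : Fin (N + 1) => vol) S =
      ∫⁻ x, Measure.pi (fun _ : Fin N => vol)
        {b | (Fin.snoc b x : Fin (N + 1) → K) ∈ S} ∂vol := by
  have h := (measurePreserving_piFinSuccAbove (fun _ : Fin (N + 1) => vol) (Fin.last N)).symm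
  rw [← h.measure_preimage hS.nullMeasurableSet, Measure.prod_apply (h.measurable hS)]
  refine lintegral_congr fun x => ?_
  congr 1
  ext b
  simp [MeasurableEquiv.piFinSuccAbove, Fin.insertNthEquiv, Fin.insertNth_last']

variable {K : Type*} [NormedField K] [MeasurableSpace K] (vol : Measure K)

/-- Once the coordinates after `l` are fixed, any two possible values of coordinate `l` differ by at
most `r l`, so they all lie in a closed ball about any one of them. Integrate over the last
coordinate and induct on the slices. -/
theorem pi_le_prod_of_dist_le [OpensMeasurableSpace K] [SigmaFinite vol] {N : ℕ}
    {S : Set (Fin N → K)} (hS : MeasurableSet S) {r : Fin N → ℝ} {M : Fin N → ℝ≥0∞}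
    (hM : ∀ l x, vol (Metric.closedBall x (r l)) ≤ M l)
    (h : ∀ a ∈ S, ∀ b ∈ S, ∀ l, (∀ i, l < i → a i = b i) → dist (a l) (b l) ≤ r l) :
    Measure.pi (fun _ : Fin N => vol) S ≤ ∏ l, M l := by
  induction N with
  | zero =>
    refine (measure_mono (Set.subset_univ S)).trans ?_
    simp
  | succ N ih =>
    rcases S.eq_empty_or_nonempty with rfl | ⟨a₀, ha₀⟩
    · simp
    rw [pi_eq_lintegral_snoc vol hS, Fin.prod_univ_castSucc]
    have key : ∀ x, Measure.pi (fun _ : Fin N => vol)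
        {b | (Fin.snoc b x : Fin (N + 1) → K) ∈ S} ≤
          (Metric.closedBall (a₀ (Fin.last N)) (r (Fin.last N))).indicator
            (fun _ => ∏ l : Fin N, M l.castSucc) x := by
      intro x
      by_cases hx : x ∈ Metric.closedBall (a₀ (Fin.last N)) (r (Fin.last N))
      · rw [Set.indicator_of_mem hx]
        refine ih (measurable_snoc x hS) (fun l y => hM _ y) fun a ha b hb l hl => ?_
        have := h _ ha _ hb l.castSucc fun i => ?_
        · simpa using this
        · refine Fin.lastCases (by simp) (fun i hi => ?_) i
          simpa using hl i (by simpa using hi)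
      · rw [Set.indicator_of_notMem hx, nonpos_iff_eq_zero]
        refine measure_mono_null (t := ∅) (fun b hb => ?_) measure_empty
        refine hx ?_
        have := h _ hb _ ha₀ (Fin.last N) fun i hi => absurd hi (Fin.le_last i).not_gt
        simpa using this
    refine (lintegral_mono key).trans ?_
    rw [lintegral_indicator_const Metric.isClosed_closedBall.measurableSet]
    gcongr
    exact hM _ _

/-- The set contains the image of a box under a unipotent shear. Each slice of that image in
coordinate `l` is a ball with a moved centre, so ball bounds uniform in the centre replace any
Jacobian or translation invariance. -/
theorem prod_le_pi_of_shear [OpensMeasurableSpace K] [SigmaFinite vol] {N : ℕ}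
    {S : Set (Fin N → K)} (hS : MeasurableSet S) {r : Fin N → ℝ} {M : Fin N → ℝ≥0∞}
    (hM : ∀ l x, M l ≤ vol (Metric.closedBall x (r l))) (g : Fin N → (Fin N → K) → K)
    (hg : ∀ l a b, (∀ i, l < i → a i = b i) → g l a = g l b)
    (h : ∀ a : Fin N → K, (∀ l, ‖a l‖ ≤ r l) → (fun l => a l + g l a) ∈ S) :
    ∏ l, M l ≤ Measure.pi (fun _ : Fin N => vol) S := by
  induction N with
  | zero =>
    have : S = Set.univ := by
      refine Set.eq_univ_of_forall fun a => ?_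
      have := h a (fun l => l.elim0)
      rwa [Subsingleton.elim (fun l => a l + g l a) a] at this
    simp [this]
  | succ N ih =>
    rw [pi_eq_lintegral_snoc vol hS, Fin.prod_univ_castSucc]
    -- No coordinate follows the last one, so the last shift is a constant and the argument `0` is
    -- arbitrary.
    set c := g (Fin.last N) 0 with hc
    have hlast : ∀ a, g (Fin.last N) a = c := fun a =>
      hg _ _ _ fun i hi => absurd hi (Fin.le_last i).not_gt
    have key : ∀ x, (Metric.closedBall c (r (Fin.last N))).indicator
          (fun _ => ∏ l : Fin N, M l.castSucc) x ≤
        Measure.pi (fun _ : Fin N => vol) {b | (Fin.snoc b x : Fin (N + 1) → K) ∈ S} := by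
      intro x
      by_cases hx : x ∈ Metric.closedBall c (r (Fin.last N))
      · rw [Set.indicator_of_mem hx]
        refine ih (measurable_snoc x hS) (fun l y => hM _ y)
          (fun l a => g l.castSucc (Fin.snoc a (x - c))) (fun l a b hl => ?_) fun a ha => ?_
        · refine hg _ _ _ fun i => ?_
          refine Fin.lastCases (by simp) (fun i hi => ?_) i
          simpa using hl i (by simpa using hi)
        · have h1 := h (Fin.snoc a (x - c)) fun l => ?_
          · refine Set.mem_preimage.2 ?_
            convert h1 using 1
            funext l
            refine Fin.lastCases ?_ (fun l => ?_) l
            · simp [hlast]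
            · simp
          · refine Fin.lastCases ?_ (fun l => ?_) l
            · simpa [dist_eq_norm] using hx
            · simpa using ha l
      · rw [Set.indicator_of_notMem hx]
        exact zero_le
    refine le_trans ?_ (lintegral_mono key)
    rw [lintegral_indicator_const Metric.isClosed_closedBall.measurableSet]
    gcongr
    exact hM _ _

end Fubini

/-! ### Volume of the unit ball of forms against Chebyshev constants -/

section FormVolume

open Polynomial

variable {K C : Type*} [NormedField K] [NormedField C] [Algebra K C]

/-- The polynomial with coefficient vector `b`. -/
def coeffPoly {F : Type*} [Field F] {n : ℕ} (b : Fin (n + 1) → F) : F[X] :=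
  ∑ i : Fin (n + 1), Polynomial.C (b i) * X ^ (i : ℕ)

theorem coeffPoly_coeff {F : Type*} [Field F] {n : ℕ} (b : Fin (n + 1) → F) (i : Fin (n + 1)) :
    (coeffPoly b).coeff i = b i := by
  rw [coeffPoly, finsetSum_coeff, Finset.sum_eq_single i]
  · simp
  · intro j _ hj
    rw [coeff_C_mul_X_pow, if_neg fun h => hj (Fin.ext h.symm)]
  · simp

theorem natDegree_coeffPoly_le {F : Type*} [Field F] {n : ℕ} (b : Fin (n + 1) → F) :
    (coeffPoly b).natDegree ≤ n :=
  natDegree_sum_le_of_forall_le _ _ fun j _ =>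
    (natDegree_C_mul_X_pow_le _ _).trans (Nat.lt_succ_iff.1 j.2)

theorem coeffPoly_eq {F : Type*} [Field F] {n : ℕ} {b : Fin (n + 1) → F} {p : F[X]}
    (hp : p.natDegree ≤ n) (h : ∀ i : Fin (n + 1), b i = p.coeff i) : coeffPoly b = p := by
  ext k
  rcases le_or_gt k n with hk | hk
  · have := coeffPoly_coeff b ⟨k, Nat.lt_succ_iff.2 hk⟩
    rw [h] at this
    exact this
  · rw [coeff_eq_zero_of_natDegree_lt ((natDegree_coeffPoly_le b).trans_lt hk),
      coeff_eq_zero_of_natDegree_lt (hp.trans_lt hk)]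

theorem formEval_map_coeffPoly {n : ℕ} (b : Fin (n + 1) → K) (z : C × C) :
    formEval n ((coeffPoly b).map (algebraMap K C)) z =
      ∑ i : Fin (n + 1), algebraMap K C (b i) * z.1 ^ (n - (i : ℕ)) * z.2 ^ (i : ℕ) := by
  rw [formEval_eq_sum]
  refine Finset.sum_congr rfl fun i _ => ?_
  rw [coeff_map, coeffPoly_coeff]

theorem aeval_binaryForm {n : ℕ} (b : Fin (n + 1) → K) (z : C × C) :
    MvPolynomial.aeval ![z.1, z.2] (binaryForm n b) =
      formEval n ((coeffPoly b).map (algebraMap K C)) z := by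
  rw [formEval_map_coeffPoly]
  simp [binaryForm]

theorem isHomogeneous_binaryForm {n : ℕ} (b : Fin (n + 1) → K) :
    (binaryForm n b).IsHomogeneous n := by
  refine MvPolynomial.IsHomogeneous.sum _ _ _ fun i _ => ?_
  have h := ((MvPolynomial.isHomogeneous_C (Fin 2) (b i)).mul
    (MvPolynomial.isHomogeneous_X_pow (R := K) (0 : Fin 2) (n - (i : ℕ)))).mul
    (MvPolynomial.isHomogeneous_X_pow (R := K) (1 : Fin 2) (i : ℕ))
  convert h using 1
  have := i.2
  omega

theorem binaryForm_mem_unitForms {E : Set (C × C)} {δ : ℕ} (hδ : δ ≠ 0) {n : ℕ}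
    (b : Fin (n + 1) → K) :
    binaryForm n b ∈ unitForms K (fun z : C => ‖z‖ ^ δ) E n ↔
      formNorm E n ((coeffPoly b).map (algebraMap K C)) ≤ 1 := by
  simp only [unitForms, Set.mem_ofPred_eq, isHomogeneous_binaryForm, true_and, supNorm, formNorm,
    iSup_le_iff, aeval_binaryForm]
  refine forall₂_congr fun z _ => ?_
  rw [ENNReal.ofReal_le_one, pow_le_one_iff_of_nonneg (norm_nonneg _) hδ, ← ofReal_norm,
    ENNReal.ofReal_le_one]

theorem measurableSet_unitForms [MeasurableSpace K] [BorelSpace K] [SecondCountableTopology K]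
    (hK : ∀ x : K, ‖algebraMap K C x‖ = ‖x‖)
    {E : Set (C × C)} {δ : ℕ} (hδ : δ ≠ 0) (n : ℕ) :
    MeasurableSet (binaryForm n ⁻¹' unitForms K (fun z : C => ‖z‖ ^ δ) E n) := by
  have hc : Continuous (algebraMap K C) :=
    (AddMonoidHomClass.isometry_of_norm (algebraMap K C) hK).continuous
  have : binaryForm n ⁻¹' unitForms K (fun z : C => ‖z‖ ^ δ) E n =
      ⋂ z ∈ E, {b | ‖formEval n ((coeffPoly b).map (algebraMap K C)) z‖ₑ ≤ 1} := by
    ext b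
    rw [Set.mem_preimage, binaryForm_mem_unitForms hδ]
    simp [formNorm]
  rw [this]
  refine (isClosed_biInter fun z _ => ?_).measurableSet
  simp only [formEval_map_coeffPoly]
  exact isClosed_le (by fun_prop) continuous_const

variable [MeasurableSpace K] [BorelSpace K] [SecondCountableTopology K]
  (vol : Measure K) [SigmaFinite vol]

/-- If two forms of norm at most `1` agree in all coefficients above `l` and differ by `e ≠ 0` in
coefficient `l`, then their difference divided by `e` is monic of degree `l` and has norm at most
`2/|e|`. So coefficient `l` varies by at most `2/T_l`, and the slicing bound applies. -/
theorem formVolume_mul_prod_chebyshev_le (hK : ∀ x : K, ‖algebraMap K C x‖ = ‖x‖)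
    {E : Set (C × C)} {R : ℝ≥0∞} (hE : ∀ z ∈ E, ‖z.1‖ₑ ≤ R ∧ ‖z.2‖ₑ ≤ R) (hR : R ≠ ∞)
    {δ : ℕ} (hδ : δ ≠ 0) {A : ℝ≥0∞}
    (hA : ∀ x r, 0 < r → vol (Metric.closedBall x r) ≤ A * ENNReal.ofReal r ^ δ) (n : ℕ)
    (hT : ∀ l : Fin (n + 1), chebyshev K E n l ≠ 0) :
    formVolume vol n (unitForms K (fun z : C => ‖z‖ ^ δ) E n) *
      (∏ l : Fin (n + 1), chebyshev K E n l) ^ δ ≤ (A * 2 ^ δ) ^ (n + 1) := by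
  have hT' : ∀ l : Fin (n + 1), chebyshev K E n l ≠ ∞ := fun l => chebyshev_ne_top hE hR n l
  have h2 : ∀ l : Fin (n + 1), 2 / chebyshev K E n l ≠ ∞ := fun l =>
    ENNReal.div_ne_top (by simp) (hT l)
  have key : formVolume vol n (unitForms K (fun z : C => ‖z‖ ^ δ) E n) ≤
      ∏ l : Fin (n + 1), A * (2 / chebyshev K E n l) ^ δ := by
    refine pi_le_prod_of_dist_le vol (measurableSet_unitForms hK hδ n)
      (r := fun l => (2 / chebyshev K E n l).toReal) (fun l x => ?_) fun a ha b hb l hl => ?_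
    · refine (hA x _ (ENNReal.toReal_pos ?_ (h2 l))).trans_eq ?_
      · simp [ENNReal.div_eq_zero_iff, hT' l]
      · rw [ENNReal.ofReal_toReal (h2 l)]
    · rw [Set.mem_preimage, binaryForm_mem_unitForms hδ] at ha hb
      rcases eq_or_ne (a l) (b l) with h0 | h0
      · rw [h0, dist_self]
        exact ENNReal.toReal_nonneg
      set e := a l - b l with he
      have he0 : e ≠ 0 := sub_ne_zero.2 h0
      set d : K[X] := coeffPoly a - coeffPoly b with hd
      have hdl : d.coeff l = e := by rw [hd, coeff_sub, coeffPoly_coeff, coeffPoly_coeff]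
      have hdeg : d.natDegree = l := by
        refine le_antisymm ?_ (le_natDegree_of_ne_zero (by rwa [hdl]))
        refine natDegree_le_iff_coeff_eq_zero.2 fun k hk => ?_
        rcases le_or_gt k n with hkn | hkn
        · have h1 := coeffPoly_coeff a ⟨k, Nat.lt_succ_iff.2 hkn⟩
          have h2 := coeffPoly_coeff b ⟨k, Nat.lt_succ_iff.2 hkn⟩
          rw [← hl ⟨k, Nat.lt_succ_iff.2 hkn⟩ (by simpa [Fin.lt_def] using hk)] at h2
          rw [hd, coeff_sub]
          exact sub_eq_zero.2 (h1.trans h2.symm)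
        · rw [hd, coeff_sub,
            coeff_eq_zero_of_natDegree_lt ((natDegree_coeffPoly_le a).trans_lt hkn),
            coeff_eq_zero_of_natDegree_lt ((natDegree_coeffPoly_le b).trans_lt hkn), sub_zero]
      have hmon : (Polynomial.C e⁻¹ * d).Monic := by
        rw [Monic, leadingCoeff_mul, leadingCoeff_C, leadingCoeff, hdeg, hdl, inv_mul_cancel₀ he0]
      have hnat : (Polynomial.C e⁻¹ * d).natDegree = l := by
        rw [natDegree_C_mul (inv_ne_zero he0), hdeg]
      have h1 := chebyshev_le (C := C) E n hmon
      rw [hnat, Polynomial.map_mul, map_C, formNorm_C_mul, hd, Polynomial.map_sub] at h1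
      have h3 : chebyshev K E n l ≤ ‖e‖ₑ⁻¹ * 2 := by
        refine h1.trans ?_
        have : ‖algebraMap K C e⁻¹‖ₑ = ‖e‖ₑ⁻¹ := by
          rw [← enorm_inv he0, ← ofReal_norm, ← ofReal_norm, hK]
        rw [this]
        gcongr
        exact (formNorm_sub_le E n _ _).trans ((add_le_add ha hb).trans_eq one_add_one_eq_two)
      have h4 : ‖e‖ₑ ≤ 2 / chebyshev K E n l := by
        rw [ENNReal.le_div_iff_mul_le (Or.inl (hT l)) (Or.inl (hT' l))]
        calc ‖e‖ₑ * chebyshev K E n l ≤ ‖e‖ₑ * (‖e‖ₑ⁻¹ * 2) := by gcongr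
          _ = 2 := by
            rw [← mul_assoc, ENNReal.mul_inv_cancel (by simpa using he0) enorm_ne_top, one_mul]
      rw [dist_eq_norm, ← he, ← toReal_enorm]
      exact ENNReal.toReal_mono (h2 l) h4
  calc _ ≤ (∏ l : Fin (n + 1), A * (2 / chebyshev K E n l) ^ δ) *
        (∏ l : Fin (n + 1), chebyshev K E n l) ^ δ := by gcongr
    _ = ∏ l : Fin (n + 1), A * 2 ^ δ := by
      rw [← Finset.prod_pow, ← Finset.prod_mul_distrib]
      refine Finset.prod_congr rfl fun l _ => ?_
      rw [mul_assoc, ← mul_pow, ENNReal.div_mul_cancel (hT l) (hT' l)]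
    _ = _ := by simp

theorem formVolume_mul_maxDet_le (hK : ∀ x : K, ‖algebraMap K C x‖ = ‖x‖)
    {E : Set (C × C)} {R : ℝ≥0∞} (hE : ∀ z ∈ E, ‖z.1‖ₑ ≤ R ∧ ‖z.2‖ₑ ≤ R) (hR : R ≠ ∞)
    {δ : ℕ} (hδ : δ ≠ 0) {A : ℝ≥0∞}
    (hA : ∀ x r, 0 < r → vol (Metric.closedBall x r) ≤ A * ENNReal.ofReal r ^ δ) (n : ℕ) :
    formVolume vol n (unitForms K (fun z : C => ‖z‖ ^ δ) E n) * maxDet E n (n + 1) ^ δ ≤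
      (A * 2 ^ δ) ^ (n + 1) * ((n + 1).factorial : ℝ≥0∞) ^ δ := by
  have h := maxDet_le_prod_chebyshev (K := K) hE hR n
  by_cases hT : ∀ l : Fin (n + 1), chebyshev K E n l ≠ 0
  · calc _ ≤ formVolume vol n (unitForms K (fun z : C => ‖z‖ ^ δ) E n) *
          ((n + 1).factorial * ∏ j : Fin (n + 1), chebyshev K E n j) ^ δ := by gcongr
      _ = formVolume vol n (unitForms K (fun z : C => ‖z‖ ^ δ) E n) *
          (∏ j : Fin (n + 1), chebyshev K E n j) ^ δ * ((n + 1).factorial : ℝ≥0∞) ^ δ := by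
        rw [mul_pow]; ring
      _ ≤ _ := by
        gcongr
        exact formVolume_mul_prod_chebyshev_le vol hK hE hR hδ hA n hT
  -- A vanishing Chebyshev constant forces the maximal determinant to vanish. The left side is then
  -- `0`, even if the volume is infinite, since `∞ * 0 = 0`.
  · push Not at hT
    obtain ⟨l, hl⟩ := hT
    rw [Finset.prod_eq_zero (Finset.mem_univ l) hl, mul_zero, nonpos_iff_eq_zero] at h
    simp [h, hδ]

/-- A combination of the `p l` with coefficients of size at most `1/((n+1) τ l)` has norm at most
`1` by the triangle inequality. These combinations fill a sheared box, because the basis of monic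
polynomials is unitriangular in the monomials. -/
theorem le_formVolume (hK : ∀ x : K, ‖algebraMap K C x‖ = ‖x‖)
    {E : Set (C × C)} {δ : ℕ} (hδ : δ ≠ 0) {B : ℝ≥0∞}
    (hB : ∀ x r, 0 < r → B * ENNReal.ofReal r ^ δ ≤ vol (Metric.closedBall x r)) (n : ℕ)
    {p : Fin (n + 1) → K[X]} (hp : ∀ l, (p l).Monic) (hd : ∀ l, (p l).natDegree = l)
    {τ : Fin (n + 1) → ℝ} (hτ : ∀ l, 0 < τ l)
    (hn : ∀ l, formNorm E n ((p l).map (algebraMap K C)) ≤ ENNReal.ofReal (τ l)) :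
    ∏ l, (B * ENNReal.ofReal (1 / ((n + 1) * τ l)) ^ δ) ≤
      formVolume vol n (unitForms K (fun z : C => ‖z‖ ^ δ) E n) := by
  have hpos : ∀ l, 0 < 1 / ((n + 1) * τ l) := fun l =>
    one_div_pos.2 (mul_pos (by positivity) (hτ l))
  refine prod_le_pi_of_shear vol (measurableSet_unitForms hK hδ n)
    (fun l x => hB x _ (hpos l))
    -- The shift is what the basis polynomials of degree greater than `l` contribute to coefficient
    -- `l`.
    (fun l a => ∑ k, if l < k then a k * (p k).coeff l else 0) (fun l a b h => ?_) fun a ha => ?_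
  · refine Finset.sum_congr rfl fun k _ => ?_
    split_ifs with hk
    · rw [h k hk]
    · rfl
  · rw [Set.mem_preimage, binaryForm_mem_unitForms hδ]
    have : (coeffPoly fun l => a l + ∑ k, if l < k then a k * (p k).coeff l else 0) =
        ∑ k, Polynomial.C (a k) * p k := by
      refine coeffPoly_eq ?_ fun l => ?_
      · refine natDegree_sum_le_of_forall_le _ _ fun k _ => (natDegree_C_mul_le _ _).trans ?_
        rw [hd]
        exact Nat.lt_succ_iff.1 k.2
      · rw [finsetSum_coeff, ← Finset.add_sum_erase _
          (fun k => (Polynomial.C (a k) * p k).coeff (l : ℕ)) (Finset.mem_univ l)]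
        have h1 := (hp l).coeff_natDegree
        rw [hd] at h1
        rw [coeff_C_mul, h1, mul_one]
        congr 1
        rw [← Finset.add_sum_erase _ _ (Finset.mem_univ l), if_neg (lt_irrefl l), zero_add]
        refine Finset.sum_congr rfl fun k hk => ?_
        rw [coeff_C_mul]
        split_ifs with hlk
        · rfl
        · rw [coeff_eq_zero_of_natDegree_lt, mul_zero]
          rw [hd]
          exact lt_of_le_of_ne (not_lt.1 hlk) fun h => Finset.ne_of_mem_erase hk (Fin.ext h)
    rw [this, Polynomial.map_sum]
    refine iSup₂_le fun z hz => ?_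
    rw [formEval_sum]
    refine (enorm_sum_le _ _).trans ?_
    have hle : ∀ k ∈ Finset.univ, ‖formEval n ((Polynomial.C (a k) * p k).map
        (algebraMap K C)) z‖ₑ ≤ ENNReal.ofReal (1 / (n + 1)) := by
      intro k _
      rw [Polynomial.map_mul, map_C, formEval_C_mul, enorm_mul]
      calc _ ≤ ENNReal.ofReal (1 / ((n + 1) * τ k)) * ENNReal.ofReal (τ k) := by
            gcongr
            · rw [← ofReal_norm, hK]
              exact ENNReal.ofReal_le_ofReal (ha k)
            · exact (enorm_formEval_le E n _ hz).trans (hn k)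
        _ = _ := by
          rw [← ENNReal.ofReal_mul (hpos k).le]
          congr 1
          have := (hτ k).ne'
          field_simp
    refine (Finset.sum_le_card_nsmul _ _ _ hle).trans ?_
    rw [Finset.card_univ, Fintype.card_fin, nsmul_eq_mul, ← ENNReal.ofReal_natCast,
      ← ENNReal.ofReal_mul (by positivity), ENNReal.ofReal_le_one]
    push_cast
    rw [mul_one_div_cancel (by positivity)]

end FormVolume

/-! ### From one degree `m` to all large degrees -/

section Asymptotics

open Polynomial

variable {K C : Type*} [NormedField K] [NormedField C] [Algebra K C]

/-- Every monic polynomial over `C` of small norm on `E` yields a power of the same norm bound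
that is attained by a monic polynomial over `K`. -/
def Descends (K : Type*) {C : Type*} [NormedField K] [NormedField C] [Algebra K C]
    (E : Set (C × C)) : Prop :=
  ∀ (m : ℕ) (p : C[X]) (t : ℝ), p.Monic → p.natDegree ≤ m → 0 < t →
    formNorm E m p < ENNReal.ofReal t → ∃ D : ℕ, 0 < D ∧ ∃ q : K[X], q.Monic ∧
      q.natDegree = p.natDegree * D ∧
      formNorm E (m * D) (q.map (algebraMap K C)) ≤ ENNReal.ofReal t ^ D

/-- Near-optimal Chebyshev polynomials over `C` descend with exponents `D j` depending on the degree
`j`. Raising each descended polynomial to a further power brings all of them to the exponent `∏ D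
j`. -/
theorem Descends.exists_common_degree {E : Set (C × C)} (hdes : Descends K E)
    (hne : E.Nonempty) {R : ℝ≥0∞} (hE : ∀ z ∈ E, ‖z.1‖ₑ ≤ R ∧ ‖z.2‖ₑ ≤ R) (hR : R ≠ ∞)
    {m : ℕ} {x : ℝ≥0∞} (hx : maxDet E m (m + 1) < x) :
    ∃ t : ℕ → ℝ, (∀ j, 0 < t j) ∧ ∏ j ∈ Finset.range (m + 1), ENNReal.ofReal (t j) < x ∧
      ∃ D : ℕ, 0 < D ∧ ∀ j ≤ m, ∃ q : K[X], q.Monic ∧ q.natDegree = j * D ∧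
        formNorm E (m * D) (q.map (algebraMap K C)) ≤ ENNReal.ofReal (t j) ^ D := by
  obtain ⟨t, ht0, htT, htx⟩ := exists_pos_gt_prod_lt (Finset.range (m + 1))
    (fun j => chebyshev_ne_top (K := C) hE hR m j)
    ((prod_chebyshev_le_maxDet hne m (m + 1)).trans_lt hx)
  refine ⟨t, ht0, htx, ?_⟩
  have hex : ∀ j, ∃ D : ℕ, 0 < D ∧ (j ≤ m → ∃ q : K[X], q.Monic ∧ q.natDegree = j * D ∧
      formNorm E (m * D) (q.map (algebraMap K C)) ≤ ENNReal.ofReal (t j) ^ D) := by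
    intro j
    by_cases hj : j ≤ m
    · obtain ⟨⟨p, hpm, hpd⟩, hp⟩ := iInf_lt_iff.1 (htT j)
      simp only [Algebra.algebraMap_self, Polynomial.map_id] at hp
      obtain ⟨D, hD, q, hq⟩ := hdes m p (t j) hpm (hpd.trans_le hj) (ht0 j) hp
      rw [hpd] at hq
      exact ⟨D, hD, fun _ => ⟨q, hq⟩⟩
    · exact ⟨1, one_pos, fun h => absurd h hj⟩
  choose D hD hq using hex
  refine ⟨∏ j ∈ Finset.range (m + 1), D j, Finset.prod_pos fun j _ => hD j, fun j hj => ?_⟩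
  obtain ⟨q, hqm, hqd, hqn⟩ := hq j hj
  obtain ⟨e, he⟩ := Finset.dvd_prod_of_mem D (Finset.mem_range.2 (Nat.lt_succ_iff.2 hj))
  refine ⟨q ^ e, hqm.pow e, ?_, ?_⟩
  · rw [hqm.natDegree_pow, hqd, he]
    ring
  · rw [he, Polynomial.map_pow, ← mul_assoc, pow_mul]
    refine (formNorm_pow_le E ?_ e).trans (pow_le_pow_left' hqn e)
    rw [natDegree_map, hqd]
    exact Nat.mul_le_mul_right _ hj

/-- Write `l = j * (A * D) + s` with `j` capped at `m`, and take `q_j ^ A * X ^ s`. The first factor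
is a form of degree `m * D * A`; the second is a form of the remaining degree `A * D + r ≥ s`, of
norm at most `R ^ (A * D + r)`. -/
theorem exists_monic_of_common_degree {E : Set (C × C)} {R : ℝ}
    (hE : ∀ z ∈ E, ‖z.1‖ₑ ≤ ENNReal.ofReal R ∧ ‖z.2‖ₑ ≤ ENNReal.ofReal R) (hR : 0 < R)
    {m D : ℕ} {t : ℕ → ℝ} (ht : ∀ j, 0 < t j)
    (hq : ∀ j ≤ m, ∃ q : K[X], q.Monic ∧ q.natDegree = j * D ∧
        formNorm E (m * D) (q.map (algebraMap K C)) ≤ ENNReal.ofReal (t j) ^ D)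
    {n A r l : ℕ} (hn : n = A * D * (m + 1) + r) (hl : l ≤ n) :
    ∃ p : K[X], p.Monic ∧ p.natDegree = l ∧ formNorm E n (p.map (algebraMap K C)) ≤
      ENNReal.ofReal (t (min m (l / (A * D))) ^ (A * D) * R ^ (A * D + r)) := by
  set j := min m (l / (A * D)) with hj
  obtain ⟨q, hqm, hqd, hqn⟩ := hq j (min_le_left _ _)
  have h1 : j * (A * D) ≤ l :=
    (Nat.mul_le_mul_right _ (min_le_right _ _)).trans (Nat.div_mul_le_self _ _)
  have h2 : l - j * (A * D) ≤ A * D + r := by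
    rcases le_total m (l / (A * D)) with h | h
    · rw [hj, min_eq_left h]
      have : A * D * (m + 1) = m * (A * D) + A * D := by ring
      omega
    · rcases Nat.eq_zero_or_pos (A * D) with h0 | h0
      · rw [h0] at hn ⊢
        omega
      · rw [hj, min_eq_right h]
        have := Nat.lt_div_mul_add (a := l) h0
        omega
  have hnn : n = m * D * A + (A * D + r) := by rw [hn]; ring
  refine ⟨q ^ A * X ^ (l - j * (A * D)), (hqm.pow A).mul (monic_X_pow _), ?_, ?_⟩
  · rw [(hqm.pow A).natDegree_mul (monic_X_pow _), hqm.natDegree_pow, hqd, natDegree_X_pow]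
    have : A * (j * D) = j * (A * D) := by ring
    omega
  · have hqle : (q.map (algebraMap K C)).natDegree ≤ m * D := by
      rw [natDegree_map, hqd]
      exact Nat.mul_le_mul_right _ (min_le_left _ _)
    rw [Polynomial.map_mul, Polynomial.map_pow, Polynomial.map_pow, map_X, hnn]
    refine (formNorm_mul_le E (n := m * D * A) ?_ ?_).trans ?_
    · exact natDegree_pow_le.trans (by rw [mul_comm]; exact Nat.mul_le_mul_right _ hqle)
    · rwa [natDegree_X_pow]
    · rw [ENNReal.ofReal_mul (pow_nonneg (ht j).le _), ENNReal.ofReal_pow (ht j).le,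
        ENNReal.ofReal_pow hR.le]
      refine mul_le_mul' ((formNorm_pow_le E hqle A).trans ?_) (formNorm_X_pow_le hE h2)
      rw [mul_comm A D, pow_mul]
      exact pow_le_pow_left' hqn A

theorem sum_range_mul_div (s : ℕ → ℝ) {a : ℕ} (ha : 0 < a) (k : ℕ) :
    ∑ l ∈ Finset.range (a * k), s (l / a) = a * ∑ j ∈ Finset.range k, s j := by
  induction k with
  | zero => simp
  | succ k ih =>
    rw [Nat.mul_succ, Finset.sum_range_add, ih, Finset.sum_range_succ, mul_add]
    congr 1
    rw [Finset.sum_congr rfl (g := fun _ => s k)]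
    · simp
    · intro l hl
      rw [Nat.mul_add_div ha, Nat.div_eq_of_lt (Finset.mem_range.1 hl), add_zero]

theorem sum_range_min_div (s : ℕ → ℝ) {a : ℕ} (ha : 0 < a) (m r : ℕ) :
    ∑ l ∈ Finset.range (a * (m + 1) + r), s (min m (l / a)) =
      a * (∑ j ∈ Finset.range (m + 1), s j) + r * s m := by
  rw [Finset.sum_range_add, ← sum_range_mul_div s ha]
  congr 1
  · refine Finset.sum_congr rfl fun l hl => ?_
    rw [min_eq_right]
    exact Nat.lt_succ_iff.1 (Nat.div_lt_of_lt_mul (Finset.mem_range.1 hl))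
  · rw [Finset.sum_congr rfl (g := fun _ => s m)]
    · simp
    · intro l _
      rw [Nat.mul_add_div ha, min_eq_left ((Nat.le_succ m).trans (Nat.le_add_right _ _))]

/-- The remainder mod `(m+1) * D` is bounded and the quotient times `D` is asymptotic to `n/(m+1)`.
So the blocks contribute `S/(m+1)²`, and the padding by powers of `X` contributes `ρ/(m+1)`. -/
theorem tendsto_block_sum (m D : ℕ) (hD : 0 < D) (S sm ρ : ℝ) :
    Tendsto (fun n : ℕ =>
      (((n / ((m + 1) * D) * D : ℕ) : ℝ) * ((n / ((m + 1) * D) * D : ℕ) * S +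
        ((n % ((m + 1) * D) + 1 : ℕ) : ℝ) * sm) +
        (n + 1) * ((n / ((m + 1) * D) * D : ℕ) + (n % ((m + 1) * D) : ℕ)) * ρ) / (n : ℝ) ^ 2)
      atTop (𝓝 (S / (m + 1) ^ 2 + ρ / (m + 1))) := by
  set Q := (m + 1) * D with hQ
  have hQ0 : 0 < Q := Nat.mul_pos (Nat.succ_pos m) hD
  have hm : (m + 1 : ℝ) ≠ 0 := by positivity
  have h1 : Tendsto (fun n : ℕ => (1 : ℝ) / n) atTop (𝓝 0) := tendsto_one_div_atTop_nhds_zero_nat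
  have hr : Tendsto (fun n : ℕ => ((n % Q : ℕ) : ℝ) / n) atTop (𝓝 0) := by
    refine squeeze_zero (fun n => by positivity) (fun n => ?_)
      (tendsto_const_div_atTop_nhds_zero_nat (Q : ℝ))
    gcongr
    exact (Nat.mod_lt n hQ0).le
  have ha : ∀ n : ℕ, ((n / Q * D : ℕ) : ℝ) = (n - (n % Q : ℕ)) / (m + 1) := by
    intro n
    rw [eq_div_iff hm, eq_sub_iff_add_eq]
    have := Nat.div_add_mod n Q
    have h2 : n / Q * D * (m + 1) + n % Q = n := by
      conv_rhs => rw [← this]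
      simp only [hQ]
      ring_nf
    exact_mod_cast h2
  have hlim : Tendsto (fun n : ℕ =>
      ((1 - ((n % Q : ℕ) : ℝ) / n) / (m + 1)) * (((1 - ((n % Q : ℕ) : ℝ) / n) / (m + 1)) * S +
        (((n % Q : ℕ) : ℝ) / n + 1 / n) * sm) + (1 + 1 / (n : ℝ)) *
        ((1 - ((n % Q : ℕ) : ℝ) / n) / (m + 1) + ((n % Q : ℕ) : ℝ) / n) * ρ)
      atTop (𝓝 (((1 - 0) / (m + 1)) * (((1 - 0) / (m + 1)) * S + (0 + 0) * sm) +
        (1 + 0) * ((1 - 0) / (m + 1) + 0) * ρ)) := by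
    have hb := (hr.const_sub 1).div_const (m + 1 : ℝ)
    exact (hb.mul ((hb.mul_const S).add ((hr.add h1).mul_const sm))).add
      (((h1.const_add 1).mul (hb.add hr)).mul_const ρ)
  have heq : ((1 - 0) / (m + 1 : ℝ)) * (((1 - 0) / (m + 1)) * S + (0 + 0) * sm) +
        (1 + 0) * ((1 - 0) / (m + 1) + 0) * ρ = S / (m + 1) ^ 2 + ρ / (m + 1) := by
    field_simp
    ring
  rw [heq] at hlim
  refine hlim.congr' ?_
  filter_upwards [eventually_gt_atTop 0] with n hn
  have hn' : (n : ℝ) ≠ 0 := by exact_mod_cast hn.ne'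
  rw [ha]
  push_cast
  field_simp

/-- The hypothesis on `maxDet` gives `∑ log t_j < c * m * (m+1) / 2`. By the block limit, the
logarithms of the norm bounds in degree `n` then sum to at most `n²/2` times a number below `c'`;
the term `2 log R / (m+1)` in `hc` pays for the padding. -/
theorem Descends.eventually_exists_monic {E : Set (C × C)} (hdes : Descends K E)
    (hne : E.Nonempty) {R : ℝ}
    (hE : ∀ z ∈ E, ‖z.1‖ₑ ≤ ENNReal.ofReal R ∧ ‖z.2‖ₑ ≤ ENNReal.ofReal R) (hR : 0 < R)
    {m : ℕ} {c c' : ℝ}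
    (hV : maxDet E m (m + 1) < ENNReal.ofReal (Real.exp (c * (m * (m + 1) / 2))))
    (hc : c * m / (m + 1) + 2 * Real.log R / (m + 1) < c') :
    ∀ᶠ n : ℕ in atTop, ∃ (p : Fin (n + 1) → K[X]) (τ : Fin (n + 1) → ℝ),
      (∀ l, (p l).Monic) ∧ (∀ l, (p l).natDegree = l) ∧ (∀ l, 0 < τ l) ∧
      (∀ l, formNorm E n ((p l).map (algebraMap K C)) ≤ ENNReal.ofReal (τ l)) ∧
      ∑ l, Real.log (τ l) ≤ c' * n ^ 2 / 2 := by
  obtain ⟨t, ht, htx, D, hD, hq⟩ := hdes.exists_common_degree hne hE ENNReal.ofReal_ne_top hV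
  set S := ∑ j ∈ Finset.range (m + 1), Real.log (t j) with hS
  have hm : (0 : ℝ) < m + 1 := by positivity
  have hSlt : S < c * (m * (m + 1) / 2) := by
    rw [← ENNReal.ofReal_prod_of_nonneg fun j _ => (ht j).le,
      ENNReal.ofReal_lt_ofReal_iff (Real.exp_pos _)] at htx
    rw [hS, ← Real.log_prod fun j _ => (ht j).ne', ← Real.log_exp (c * (m * (m + 1) / 2))]
    exact Real.log_lt_log (Finset.prod_pos fun j _ => ht j) htx
  have hlim := tendsto_block_sum m D hD S (Real.log (t m)) (Real.log R)
  have hlt : S / (m + 1) ^ 2 + Real.log R / (m + 1) < c' / 2 := by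
    have : S / (m + 1) ^ 2 < c * m / (m + 1) / 2 := by
      rw [div_lt_iff₀ (by positivity)]
      refine hSlt.trans_eq ?_
      field_simp
    have h2 : Real.log R / (m + 1) = 2 * Real.log R / (m + 1) / 2 := by ring
    linarith
  filter_upwards [hlim.eventually (gt_mem_nhds hlt), eventually_ge_atTop ((m + 1) * D),
    eventually_gt_atTop 0] with n hn hnQ hn0
  set A := n / ((m + 1) * D) with hA
  set r := n % ((m + 1) * D) with hr
  have hnn : n = A * D * (m + 1) + r := by
    conv_lhs => rw [← Nat.div_add_mod n ((m + 1) * D), ← hA, ← hr]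
    ring
  have hA0 : 0 < A := Nat.div_pos hnQ (Nat.mul_pos (Nat.succ_pos m) hD)
  choose p hpm hpd hpn using fun l : Fin (n + 1) =>
    exists_monic_of_common_degree hE hR ht hq hnn (Nat.lt_succ_iff.1 l.2)
  refine ⟨p, _, hpm, hpd, fun l => mul_pos (pow_pos (ht _) _) (pow_pos hR _), hpn, ?_⟩
  have hlog : ∀ l : Fin (n + 1),
      Real.log (t (min m ((l : ℕ) / (A * D))) ^ (A * D) * R ^ (A * D + r)) =
        ((A * D : ℕ) : ℝ) * Real.log (t (min m ((l : ℕ) / (A * D)))) +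
          ((A * D : ℕ) + (r : ℕ)) * Real.log R := by
    intro l
    rw [Real.log_mul (pow_pos (ht _) _).ne' (pow_pos hR _).ne', Real.log_pow, Real.log_pow]
    push_cast
    ring
  rw [Finset.sum_congr rfl fun l _ => hlog l, Finset.sum_add_distrib, ← Finset.mul_sum,
    Fin.sum_univ_eq_sum_range (fun l => Real.log (t (min m (l / (A * D))))) (n + 1)]
  -- The remainder is `r + 1`, since the degrees `0, …, n` are `n + 1` in number.
  have hsum := sum_range_min_div (fun j => Real.log (t j)) (Nat.mul_pos hA0 hD) m (r + 1)
  rw [← add_assoc, ← hnn] at hsum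
  rw [hsum]
  rw [div_lt_iff₀ (by positivity)] at hn
  refine le_trans (le_of_eq ?_) (hn.le.trans_eq (by ring))
  simp
  ring

end Asymptotics

/-! ### Existence of the limits and their equality -/

section Capacity

open Polynomial

variable {K C : Type*} [NormedField K] [NormedField C] [Algebra K C]

/-- The wedge product is the squared determinant, and a positive power is an order isomorphism of
`[0, ∞]`, so it commutes with the supremum. -/
theorem homDiameter_succ (E : Set (C × C)) {δ : ℕ} (hδ : δ ≠ 0) {n : ℕ} (hn : 0 < n) :
    homDiameter (fun z : C => ‖z‖ ^ δ) E (n + 1) =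
      maxDet E n (n + 1) ^ (δ * (2 / (n * (n + 1))) : ℝ) := by
  have hx : 0 < (δ * (2 / (n * (n + 1))) : ℝ) := by positivity
  have hterm : ∀ z : Fin (n + 1) → E,
      (∏ p : Fin (n + 1) × Fin (n + 1) with p.1 ≠ p.2,
        ENNReal.ofReal (‖wedge (z p.1 : C × C) (z p.2 : C × C)‖ ^ δ)) ^
        (1 / (((n + 1 : ℕ) : ℝ) * (((n + 1 : ℕ) : ℝ) - 1))) =
      ‖formDet n (n + 1) (fun i => (z i : C × C))‖ₑ ^ (δ * (2 / (n * (n + 1))) : ℝ) := by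
    intro z
    simp_rw [ENNReal.ofReal_pow (norm_nonneg _), ofReal_norm]
    rw [Finset.prod_pow, enorm_formDet n (fun i => (z i : C × C)), ← pow_mul,
      ← ENNReal.rpow_natCast, ← ENNReal.rpow_mul]
    congr 1
    push_cast
    have : (n : ℝ) ≠ 0 := by exact_mod_cast hn.ne'
    rw [add_sub_cancel_right]
    field_simp
  simp only [homDiameter, hterm, maxDet]
  exact ((ENNReal.orderIsoRpow _ hx).map_iSup
    fun z : Fin (n + 1) → E => ‖formDet n (n + 1) (fun i => (z i : C × C))‖ₑ).symm

theorem ofReal_exp_rpow (x y : ℝ) :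
    ENNReal.ofReal (Real.exp x) ^ y = ENNReal.ofReal (Real.exp (x * y)) := by
  rw [ENNReal.ofReal_rpow_of_pos (Real.exp_pos x), Real.exp_mul]

theorem maxDet_lt_iff (E : Set (C × C)) {δ : ℕ} (hδ : δ ≠ 0) {n : ℕ} (hn : 0 < n) (c : ℝ) :
    maxDet E n (n + 1) < ENNReal.ofReal (Real.exp (c * (n * (n + 1) / 2))) ↔
      homDiameter (fun z : C => ‖z‖ ^ δ) E (n + 1) < ENNReal.ofReal (Real.exp (δ * c)) := by
  have hx : 0 < (δ * (2 / (n * (n + 1))) : ℝ) := by positivity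
  rw [homDiameter_succ E hδ hn, ← ENNReal.rpow_lt_rpow_iff hx, ofReal_exp_rpow]
  have : c * (n * (n + 1) / 2) * (δ * (2 / (n * (n + 1)))) = δ * c := by
    have : (n : ℝ) ≠ 0 := by exact_mod_cast hn.ne'
    field_simp
  rw [this]

theorem log_ofReal_exp (y : ℝ) : ENNReal.log (ENNReal.ofReal (Real.exp y)) = y := by
  rw [← EReal.exp_coe, EReal.log_exp]

theorem tendsto_log_succ_div : Tendsto (fun n : ℕ => Real.log (n + 1) / (n : ℝ)) atTop (𝓝 0) := by
  have h1 : Tendsto (fun n : ℕ => Real.log ((n + 1 : ℕ) : ℝ) / ((n + 1 : ℕ) : ℝ)) atTop (𝓝 0) :=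
    (Real.isLittleO_log_id_atTop.tendsto_div_nhds_zero.comp tendsto_natCast_atTop_atTop).comp
      (tendsto_add_atTop_nat 1)
  have h2 : Tendsto (fun n : ℕ => 1 + (1 : ℝ) / n) atTop (𝓝 (1 + 0)) :=
    tendsto_one_div_atTop_nhds_zero_nat.const_add 1
  have h := h1.mul h2
  rw [zero_mul] at h
  refine h.congr' ?_
  filter_upwards [eventually_gt_atTop 0] with n hn
  have hn' : (n : ℝ) ≠ 0 := by exact_mod_cast hn.ne'
  push_cast
  field_simp

theorem log_factorial_le (n : ℕ) :
    Real.log ((n + 1).factorial : ℝ) ≤ (n + 1) * Real.log (n + 1) := by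
  have h : ((n + 1).factorial : ℝ) ≤ (n + 1 : ℝ) ^ (n + 1) := by
    exact_mod_cast Nat.factorial_le_pow (n + 1)
  refine (Real.log_le_log (by exact_mod_cast Nat.factorial_pos _) h).trans_eq ?_
  rw [Real.log_pow]
  push_cast
  ring

theorem tendsto_error (a b c : ℝ) :
    Tendsto (fun n : ℕ => (a * (n + 1) + b * ((n + 1) * Real.log (n + 1)) + c * n) / (n : ℝ) ^ 2)
      atTop (𝓝 0) := by
  have h1 : Tendsto (fun n : ℕ => (1 : ℝ) / n) atTop (𝓝 0) := tendsto_one_div_atTop_nhds_zero_nat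
  have h2 := tendsto_log_succ_div
  have h := ((((h1.const_add 1).mul h1).const_mul a).add
    (((h1.const_add 1).mul h2).const_mul b)).add (h1.const_mul c)
  simp only [mul_zero, add_zero] at h
  refine h.congr' ?_
  filter_upwards [eventually_gt_atTop 0] with n hn
  have hn' : (n : ℝ) ≠ 0 := by exact_mod_cast hn.ne'
  field_simp

theorem le_logVolume_of_le [MeasurableSpace K] {vol : Measure K}
    {E : Set (C × C)} {abv : C → ℝ} {n : ℕ} {y : ℝ}
    (h : ENNReal.ofReal (Real.exp y) ≤ formVolume vol n (unitForms K abv E n)) :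
    ((2 / (n : ℝ) ^ 2 * y : ℝ) : EReal) ≤ logVolume vol abv E n := by
  rw [logVolume, EReal.coe_mul, ← log_ofReal_exp y]
  exact mul_le_mul_of_nonneg_left (ENNReal.log_monotone h)
    (EReal.coe_nonneg.2 (by positivity))

theorem logVolume_le_of_le [MeasurableSpace K] {vol : Measure K}
    {E : Set (C × C)} {abv : C → ℝ} {n : ℕ} {y : ℝ}
    (h : formVolume vol n (unitForms K abv E n) ≤ ENNReal.ofReal (Real.exp y)) :
    logVolume vol abv E n ≤ ((2 / (n : ℝ) ^ 2 * y : ℝ) : EReal) := by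
  rw [logVolume, EReal.coe_mul, ← log_ofReal_exp y]
  exact mul_le_mul_of_nonneg_left (ENNReal.log_monotone h)
    (EReal.coe_nonneg.2 (by positivity))

/-- The Fekete step: smallness at a single `m` bounds the diameters for all large `n`. An
intermediate `c₁ < c'` absorbs the factor `(n+1)!` and the gap between `n²` and `n * (n+1)`. -/
theorem eventually_homDiameter_le {E : Set (C × C)} (hdes : Descends K E)
    (hne : E.Nonempty) {R : ℝ}
    (hE : ∀ z ∈ E, ‖z.1‖ₑ ≤ ENNReal.ofReal R ∧ ‖z.2‖ₑ ≤ ENNReal.ofReal R) (hR : 0 < R)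
    {δ : ℕ} (hδ : δ ≠ 0) {m : ℕ} {c c' : ℝ}
    (hV : maxDet E m (m + 1) < ENNReal.ofReal (Real.exp (c * (m * (m + 1) / 2))))
    (hc : c * m / (m + 1) + 2 * Real.log R / (m + 1) < c') :
    ∀ᶠ n : ℕ in atTop,
      homDiameter (fun z : C => ‖z‖ ^ δ) E n ≤ ENNReal.ofReal (Real.exp (δ * c')) := by
  obtain ⟨c₁, hc₁, hc₁'⟩ := exists_between hc
  have herr := tendsto_error 0 1 (-(c' / 2))
  rw [← map_add_atTop_eq_nat 1, eventually_map]
  filter_upwards [hdes.eventually_exists_monic hne hE hR hV hc₁,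
    herr.eventually (gt_mem_nhds (half_pos (sub_pos.2 hc₁'))), eventually_gt_atTop 0]
    with n ⟨p, τ, hpm, hpd, hτ, hpn, hsum⟩ hn hn0
  have hn' : (0 : ℝ) < n := by exact_mod_cast hn0
  refine ((maxDet_lt_iff E hδ hn0 c').1 ?_).le
  have h := maxDet_le_prod_formNorm E n (p := fun l => (p l).map (algebraMap K C))
    (fun l => (hpm l).map _) (fun l => by rw [natDegree_map, hpd])
  refine (h.trans (mul_le_mul_right (Finset.prod_le_prod' fun l _ => hpn l) _)).trans_lt ?_
  have hf : (0 : ℝ) < ((n + 1).factorial : ℝ) := by exact_mod_cast Nat.factorial_pos _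
  have hprod : 0 < ∏ l, τ l := Finset.prod_pos fun l _ => hτ l
  rw [← ENNReal.ofReal_prod_of_nonneg fun l _ => (hτ l).le, ← ENNReal.ofReal_natCast,
    ← ENNReal.ofReal_mul hf.le, ENNReal.ofReal_lt_ofReal_iff (Real.exp_pos _),
    ← Real.exp_log (mul_pos hf hprod), Real.exp_lt_exp, Real.log_mul hf.ne' hprod.ne',
    Real.log_prod fun l _ => (hτ l).ne']
  rw [div_lt_iff₀ (by positivity)] at hn
  have := log_factorial_le n
  nlinarith

section Volume

variable [MeasurableSpace K] [BorelSpace K] [SecondCountableTopology K]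
  {vol : Measure K} [SigmaFinite vol]

theorem eventually_le_logVolume (hK : ∀ x : K, ‖algebraMap K C x‖ = ‖x‖)
    {E : Set (C × C)} (hdes : Descends K E)
    (hne : E.Nonempty) {R : ℝ}
    (hE : ∀ z ∈ E, ‖z.1‖ₑ ≤ ENNReal.ofReal R ∧ ‖z.2‖ₑ ≤ ENNReal.ofReal R) (hR : 0 < R)
    {δ : ℕ} (hδ : δ ≠ 0) {B : ℝ} (hB0 : 0 < B)
    (hB : ∀ x r, 0 < r →
      ENNReal.ofReal B * ENNReal.ofReal r ^ δ ≤ vol (Metric.closedBall x r))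
    {m : ℕ} {c c' : ℝ}
    (hV : maxDet E m (m + 1) < ENNReal.ofReal (Real.exp (c * (m * (m + 1) / 2))))
    (hc : c * m / (m + 1) + 2 * Real.log R / (m + 1) < c') :
    ∀ᶠ n : ℕ in atTop,
      ((-(δ * c') : ℝ) : EReal) ≤ logVolume vol (fun z : C => ‖z‖ ^ δ) E n := by
  obtain ⟨c₁, hc₁, hc₁'⟩ := exists_between hc
  have hδ0 : (0 : ℝ) < δ := by positivity
  have herr := tendsto_error (2 * Real.log B) (-(2 * δ)) 0
  have hlt : -(δ * (c' - c₁)) < 0 := by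
    have := mul_pos hδ0 (sub_pos.2 hc₁')
    linarith
  filter_upwards [hdes.eventually_exists_monic hne hE hR hV hc₁, herr.eventually (lt_mem_nhds hlt),
    eventually_gt_atTop 0] with n ⟨p, τ, hpm, hpd, hτ, hpn, hsum⟩ hn hn0
  have hn' : (0 : ℝ) < n := by exact_mod_cast hn0
  have h := le_formVolume vol hK hδ hB n hpm hpd hτ hpn
  have hprod : ∏ l, (ENNReal.ofReal B * ENNReal.ofReal (1 / ((n + 1) * τ l)) ^ δ) =
      ENNReal.ofReal (Real.exp ((n + 1) * Real.log B - δ * ((n + 1) * Real.log (n + 1)) -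
        δ * ∑ l, Real.log (τ l))) := by
    have hl : ∀ l, ENNReal.ofReal B * ENNReal.ofReal (1 / ((n + 1) * τ l)) ^ δ =
        ENNReal.ofReal (Real.exp (Real.log B - δ * Real.log (n + 1) - δ * Real.log (τ l))) := by
      intro l
      have h1 : 0 < 1 / ((n + 1) * τ l) := one_div_pos.2 (mul_pos (by positivity) (hτ l))
      rw [← ENNReal.ofReal_pow h1.le, ← ENNReal.ofReal_mul hB0.le]
      congr 1
      rw [← Real.exp_log (mul_pos hB0 (pow_pos h1 δ)), Real.log_mul hB0.ne' (pow_pos h1 δ).ne',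
        Real.log_pow, one_div, Real.log_inv, Real.log_mul (by positivity) (hτ l).ne']
      congr 1
      ring
    rw [Finset.prod_congr rfl fun l _ => hl l,
      ← ENNReal.ofReal_prod_of_nonneg fun l _ => (Real.exp_pos _).le, ← Real.exp_sum]
    congr 2
    rw [Finset.sum_sub_distrib, ← Finset.mul_sum]
    simp
    ring
  rw [hprod] at h
  refine le_trans (EReal.coe_le_coe_iff.2 ?_) (le_logVolume_of_le h)
  have h2 : (n + 1) * Real.log B - δ * ((n + 1) * Real.log (n + 1)) - δ * (c₁ * n ^ 2 / 2) ≤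
      (n + 1) * Real.log B - δ * ((n + 1) * Real.log (n + 1)) - δ * ∑ l, Real.log (τ l) := by
    gcongr
  refine le_trans ?_ (mul_le_mul_of_nonneg_left h2 (by positivity))
  have h3 : 2 / (n : ℝ) ^ 2 * ((n + 1) * Real.log B - δ * ((n + 1) * Real.log (n + 1)) -
      δ * (c₁ * n ^ 2 / 2)) = (2 * Real.log B * (n + 1) +
        -(2 * δ) * ((n + 1) * Real.log (n + 1)) + 0 * n) / (n : ℝ) ^ 2 - δ * c₁ := by
    field_simp
    ring
  rw [h3]
  linarith

theorem eventually_logVolume_le (hK : ∀ x : K, ‖algebraMap K C x‖ = ‖x‖)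
    {E : Set (C × C)} {R : ℝ}
    (hE : ∀ z ∈ E, ‖z.1‖ₑ ≤ ENNReal.ofReal R ∧ ‖z.2‖ₑ ≤ ENNReal.ofReal R)
    {δ : ℕ} (hδ : δ ≠ 0) {A : ℝ} (hA0 : 0 < A)
    (hA : ∀ x r, 0 < r →
      vol (Metric.closedBall x r) ≤ ENNReal.ofReal A * ENNReal.ofReal r ^ δ)
    {c c' : ℝ} (hc : c' < c) (hd : ∀ᶠ n : ℕ in atTop,
      ENNReal.ofReal (Real.exp (δ * c)) ≤ homDiameter (fun z : C => ‖z‖ ^ δ) E n) :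
    ∀ᶠ n : ℕ in atTop,
      logVolume vol (fun z : C => ‖z‖ ^ δ) E n ≤ ((-(δ * c') : ℝ) : EReal) := by
  have hδ0 : (0 : ℝ) < δ := by positivity
  have herr := tendsto_error (2 * Real.log (A * 2 ^ δ)) (2 * δ) (-(δ * c))
  have hlt : 0 < δ * (c - c') := mul_pos hδ0 (sub_pos.2 hc)
  filter_upwards [(tendsto_add_atTop_nat 1).eventually hd, herr.eventually (gt_mem_nhds hlt),
    eventually_gt_atTop 0] with n hdn hn hn0
  have hn' : (0 : ℝ) < n := by exact_mod_cast hn0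
  have hV : ENNReal.ofReal (Real.exp (c * (n * (n + 1) / 2))) ≤ maxDet E n (n + 1) := by
    rw [← not_lt, maxDet_lt_iff E hδ hn0, not_lt]
    exact hdn
  have h := formVolume_mul_maxDet_le vol hK hE ENNReal.ofReal_ne_top hδ hA n
  have hA2 : 0 < A * 2 ^ δ := by positivity
  have hvol : formVolume vol n (unitForms K (fun z : C => ‖z‖ ^ δ) E n) ≤
      ENNReal.ofReal (Real.exp ((n + 1) * Real.log (A * 2 ^ δ) +
        δ * Real.log ((n + 1).factorial : ℝ) - δ * (c * (n * (n + 1) / 2)))) := by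
    rw [Real.exp_sub, ENNReal.ofReal_div_of_pos (Real.exp_pos _),
      ENNReal.le_div_iff_mul_le (Or.inl (by simp [Real.exp_pos])) (Or.inl ENNReal.ofReal_ne_top)]
    refine le_trans ?_ (h.trans_eq ?_)
    · gcongr
      rw [Real.exp_nat_mul, ENNReal.ofReal_pow (Real.exp_pos _).le]
      gcongr
    · have hf : (0 : ℝ) < ((n + 1).factorial : ℝ) := by exact_mod_cast Nat.factorial_pos _
      have e1 : ENNReal.ofReal A * 2 ^ δ = ENNReal.ofReal (A * 2 ^ δ) := by
        rw [ENNReal.ofReal_mul hA0.le, ENNReal.ofReal_pow (by norm_num)]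
        simp
      rw [Real.exp_add, Real.exp_nat_mul, Real.exp_log hf, ← Nat.cast_add_one, Real.exp_nat_mul,
        Real.exp_log hA2, ENNReal.ofReal_mul (by positivity), ENNReal.ofReal_pow hA2.le,
        ENNReal.ofReal_pow hf.le, ENNReal.ofReal_natCast, e1]
  refine (logVolume_le_of_le hvol).trans (EReal.coe_le_coe_iff.2 ?_)
  have h2 : (n + 1) * Real.log (A * 2 ^ δ) + δ * Real.log ((n + 1).factorial : ℝ) -
      δ * (c * (n * (n + 1) / 2)) ≤ (n + 1) * Real.log (A * 2 ^ δ) +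
        δ * ((n + 1) * Real.log (n + 1)) - δ * (c * (n * (n + 1) / 2)) := by
    gcongr
    exact log_factorial_le n
  refine (mul_le_mul_of_nonneg_left h2 (by positivity)).trans ?_
  have h3 : 2 / (n : ℝ) ^ 2 * ((n + 1) * Real.log (A * 2 ^ δ) +
        δ * ((n + 1) * Real.log (n + 1)) - δ * (c * (n * (n + 1) / 2))) =
      (2 * Real.log (A * 2 ^ δ) * (n + 1) + 2 * δ * ((n + 1) * Real.log (n + 1)) +
        -(δ * c) * n) / (n : ℝ) ^ 2 - δ * c := by
    field_simp
    ring
  rw [h3]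
  linarith

/-- Density of the reals in `EReal`, transported by the logarithm; the endpoints `0` and `∞` are
allowed. -/
theorem exists_ofReal_exp_between {δ : ℕ} (hδ : δ ≠ 0) {a b : ℝ≥0∞} (h : a < b) :
    ∃ c : ℝ, a < ENNReal.ofReal (Real.exp (δ * c)) ∧ ENNReal.ofReal (Real.exp (δ * c)) < b := by
  have h' : ENNReal.log a < ENNReal.log b := ENNReal.log_strictMono h
  obtain ⟨x, hx, hx'⟩ := EReal.lt_iff_exists_real_btwn.1 h'
  refine ⟨x / δ, ?_, ?_⟩ <;>
  · rw [mul_div_cancel₀ _ (by exact_mod_cast hδ), ← ENNReal.log_lt_log_iff, log_ofReal_exp]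
    assumption

/-- Existence and equality of the homogeneous transfinite diameter and the homogeneous sectional
capacity, for the absolute value `‖·‖ ^ δ`. -/
theorem homSectionalCapacity_eq_of_descends (hK : ∀ x : K, ‖algebraMap K C x‖ = ‖x‖)
    {E : Set (C × C)} (hdes : Descends K E) (hne : E.Nonempty) (hbdd : Bornology.IsBounded E)
    {δ : ℕ} (hδ : δ ≠ 0) {A B : ℝ} (hA0 : 0 < A) (hB0 : 0 < B)
    (hA : ∀ x r, 0 < r →
      vol (Metric.closedBall x r) ≤ ENNReal.ofReal A * ENNReal.ofReal r ^ δ)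
    (hB : ∀ x r, 0 < r →
      ENNReal.ofReal B * ENNReal.ofReal r ^ δ ≤ vol (Metric.closedBall x r))
    {abv : C → ℝ} (habv : abv = fun z => ‖z‖ ^ δ) :
    Tendsto (homDiameter abv E) atTop (𝓝 (homTransfiniteDiameter abv E)) ∧
      Tendsto (logVolume vol abv E) atTop
        (𝓝 (-ENNReal.log (homSectionalCapacity vol abv E))) ∧
      homTransfiniteDiameter abv E ≠ ∞ ∧
      homSectionalCapacity vol abv E = homTransfiniteDiameter abv E := by
  subst habv
  have hδ0 : (0 : ℝ) < δ := by positivity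
  obtain ⟨R, hR, hE⟩ : ∃ R : ℝ, 0 < R ∧
      ∀ z ∈ E, ‖z.1‖ₑ ≤ ENNReal.ofReal R ∧ ‖z.2‖ₑ ≤ ENNReal.ofReal R := by
    obtain ⟨R, hR, hE⟩ := hbdd.exists_pos_norm_le
    refine ⟨R, hR, fun z hz => ?_⟩
    rw [← ofReal_norm, ← ofReal_norm]
    exact ⟨ENNReal.ofReal_le_ofReal ((norm_fst_le z).trans (hE z hz)),
      ENNReal.ofReal_le_ofReal ((norm_snd_le z).trans (hE z hz))⟩
  set hd := homDiameter (fun z : C => ‖z‖ ^ δ) E with hhd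
  set d := liminf hd atTop with hdd
  have hslope : ∀ c c' : ℝ, c < c' → ∀ᶠ m : ℕ in atTop,
      c * m / (m + 1) + 2 * Real.log R / (m + 1) < c' := by
    intro c c' hc
    have h1 := (tendsto_natCast_div_add_atTop (𝕜 := ℝ) (1 : ℝ)).const_mul c
    have h2 := (tendsto_one_div_add_atTop_nhds_zero_nat (𝕜 := ℝ)).const_mul (2 * Real.log R)
    have h := h1.add h2
    rw [mul_one, mul_zero, add_zero] at h
    filter_upwards [h.eventually (gt_mem_nhds hc)] with m hm
    rwa [← mul_div_assoc, ← mul_div_assoc, mul_one] at hm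
  -- As `d` is a liminf, small diameters occur for arbitrarily large `m`, so `m` can be taken large
  -- enough for the padding cost to fit below `c'`.
  have hstep : ∀ c c' : ℝ, c < c' → d < ENNReal.ofReal (Real.exp (δ * c)) → ∃ m : ℕ,
      maxDet E m (m + 1) < ENNReal.ofReal (Real.exp (c * (m * (m + 1) / 2))) ∧
      c * m / (m + 1) + 2 * Real.log R / (m + 1) < c' := by
    intro c c' hc hdc
    have hfreq : ∃ᶠ n in atTop, hd n < ENNReal.ofReal (Real.exp (δ * c)) :=
      frequently_lt_of_liminf_lt (by isBoundedDefault) hdc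
    rw [← map_add_atTop_eq_nat 1, frequently_map] at hfreq
    obtain ⟨m, hm, hm', hm0⟩ :=
      (hfreq.and_eventually ((hslope c c' hc).and (eventually_gt_atTop 0))).exists
    exact ⟨m, (maxDet_lt_iff E hδ hm0 c).2 hm, hm'⟩
  have hd_lim : Tendsto hd atTop (𝓝 d) := by
    refine tendsto_of_le_liminf_of_limsup_le le_rfl (le_of_forall_gt fun b hb => ?_)
    obtain ⟨c', hdc', hcb⟩ := exists_ofReal_exp_between hδ hb
    obtain ⟨c, hdc, hcc'⟩ := exists_ofReal_exp_between hδ hdc'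
    have hc : c < c' := by
      rw [ENNReal.ofReal_lt_ofReal_iff (Real.exp_pos _), Real.exp_lt_exp] at hcc'
      exact lt_of_mul_lt_mul_left hcc' hδ0.le
    obtain ⟨m, hm, hm'⟩ := hstep c c' hc hdc
    exact (limsup_le_of_le (by isBoundedDefault)
      (eventually_homDiameter_le hdes hne hE hR hδ hm hm')).trans_lt hcb
  -- The Fekete step already applies at `m = 1`, with any `c` for which the determinant is below
  -- `exp c`; no smallness is needed for finiteness.
  have hfin : d ≠ ∞ := by
    have hV : maxDet E 1 (1 + 1) < ∞ := by
      refine (maxDet_le_prod_formNorm E 1 (p := fun j => X ^ (j : ℕ)) (fun j => monic_X_pow _)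
        (fun j => natDegree_X_pow _)).trans_lt ?_
      refine ENNReal.mul_lt_top (ENNReal.natCast_lt_top _) ?_
      exact ENNReal.prod_lt_top fun j _ =>
        (formNorm_ne_top hE ENNReal.ofReal_ne_top _ _).lt_top
    obtain ⟨c, hc, -⟩ := exists_ofReal_exp_between one_ne_zero hV
    have hc' : maxDet E 1 (1 + 1) <
        ENNReal.ofReal (Real.exp (c * ((1 : ℕ) * ((1 : ℕ) + 1) / 2))) := by
      convert hc using 3
      push_cast
      ring
    have := eventually_homDiameter_le hdes hne hE hR hδ hc' (lt_add_one _)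
    exact ne_top_of_le_ne_top ENNReal.ofReal_ne_top (le_of_tendsto hd_lim this)
  have hvol_lim : Tendsto (logVolume vol (fun z : C => ‖z‖ ^ δ) E) atTop
      (𝓝 (-ENNReal.log d)) := by
    -- Working in the order of `EReal` covers `d = 0`, where the limit is `⊤`. The lower bound uses
    -- polynomials descended from one `m`; the upper bound uses the diameter limit just established.
    refine tendsto_order.2 ⟨fun b hb => ?_, fun b hb => ?_⟩
    · rw [EReal.lt_neg_comm] at hb
      obtain ⟨x', hdx', hxb⟩ := EReal.lt_iff_exists_real_btwn.1 hb
      obtain ⟨x, hdx, hxx'⟩ := EReal.lt_iff_exists_real_btwn.1 hdx'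
      rw [← log_ofReal_exp, ENNReal.log_lt_log_iff] at hdx
      have hdc : d < ENNReal.ofReal (Real.exp (δ * (x / δ))) := by
        rwa [mul_div_cancel₀ _ hδ0.ne']
      obtain ⟨m, hm, hm'⟩ := hstep (x / δ) (x' / δ)
        (by gcongr; exact EReal.coe_lt_coe_iff.1 hxx') hdc
      filter_upwards [eventually_le_logVolume hK hdes hne hE hR hδ hB0 hB hm hm'] with n hn
      refine lt_of_lt_of_le ?_ hn
      rw [mul_div_cancel₀ _ hδ0.ne', EReal.coe_neg]
      exact EReal.lt_neg_comm.1 hxb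
    · rw [gt_iff_lt, EReal.neg_lt_comm] at hb
      obtain ⟨x', hbx', hxd'⟩ := EReal.lt_iff_exists_real_btwn.1 hb
      obtain ⟨x, hxx', hxd⟩ := EReal.lt_iff_exists_real_btwn.1 hxd'
      rw [← log_ofReal_exp, ENNReal.log_lt_log_iff] at hxd
      have hdc : ∀ᶠ n in atTop, ENNReal.ofReal (Real.exp (δ * (x / δ))) ≤ hd n := by
        rw [mul_div_cancel₀ _ hδ0.ne']
        exact (hd_lim.eventually (lt_mem_nhds hxd)).mono fun n hn => hn.le
      filter_upwards [eventually_logVolume_le hK hE hδ hA0 hA (c' := x' / δ)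
        (by gcongr; exact EReal.coe_lt_coe_iff.1 hxx') hdc] with n hn
      refine lt_of_le_of_lt hn ?_
      rw [mul_div_cancel₀ _ hδ0.ne', EReal.coe_neg]
      exact EReal.neg_lt_comm.1 hbx'
  have hT : homTransfiniteDiameter (fun z : C => ‖z‖ ^ δ) E = d := hd_lim.limUnder_eq
  have hS : homSectionalCapacity vol (fun z : C => ‖z‖ ^ δ) E = d := by
    rw [homSectionalCapacity, hvol_lim.limUnder_eq, neg_neg, ENNReal.exp_log]
  rw [hT, hS]
  exact ⟨hd_lim, hvol_lim, hfin, rfl⟩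

end Volume

end Capacity

/-! ### Galois action on forms -/

section Descent

open Polynomial

variable {K C : Type*} [NormedField K] [NormedField C] [Algebra K C]

theorem formEval_map (σ : C →+* C) (n : ℕ) (p : C[X]) (z : C × C) :
    formEval n (p.map σ) (σ z.1, σ z.2) = σ (formEval n p z) := by
  simp [formEval_eq_sum, map_sum]

/-- The conjugate form at `z` takes the value `σ (p (σ⁻¹ z))`, and `σ⁻¹ z` is again in `E`. -/
theorem GaloisStable.formNorm_map_le {E : Set (C × C)} (hE : GaloisStable K E)
    (σ : C ≃A[K] C) (hσ : ∀ x, ‖σ x‖ = ‖x‖) (n : ℕ) (p : C[X]) :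
    formNorm E n (p.map (σ : C →+* C)) ≤ formNorm E n p := by
  refine iSup₂_le fun z hz => ?_
  have h : formEval n (p.map (σ : C →+* C)) z = σ (formEval n p (σ.symm z.1, σ.symm z.2)) := by
    have := formEval_map (σ : C →+* C) n p (σ.symm z.1, σ.symm z.2)
    simpa using this
  rw [h, ← ofReal_norm, hσ, ofReal_norm]
  exact enorm_formEval_le E n p (hE σ.symm z hz)

end Descent

/-! ### Archimedean places -/

section Archimedean

open Polynomial ComplexConjugate

variable {k : Type*} [Field k] (w : InfinitePlace k)

theorem arch_norm_algebraMap (x : w.Completion) : ‖algebraMap w.Completion ℂ x‖ = ‖x‖ :=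
  (InfinitePlace.Completion.isometry_extensionEmbedding w).norm_map_of_map_zero (map_zero _) x

instance archSecondCountable : SecondCountableTopology w.Completion :=
  (InfinitePlace.Completion.isometry_extensionEmbedding w).isEmbedding.secondCountableTopology

theorem archVol_closedBall_of_isReal (hw : w.IsReal) (x : w.Completion) (r : ℝ) :
    archVol w (Metric.closedBall x r) = ENNReal.ofReal (2 * r) := by
  set e := InfinitePlace.Completion.isometryEquivRealOfIsReal hw
  rw [archVol, dif_pos hw,
    Measure.map_apply e.symm.continuous.measurable Metric.isClosed_closedBall.measurableSet,
    e.symm.preimage_closedBall, Real.volume_closedBall]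

theorem archVol_closedBall_of_isComplex (hw : w.IsComplex) (x : w.Completion) (r : ℝ) :
    archVol w (Metric.closedBall x r) = ENNReal.ofReal r ^ 2 * NNReal.pi := by
  set e := InfinitePlace.Completion.isometryEquivComplexOfIsComplex hw
  rw [archVol, dif_neg (InfinitePlace.not_isReal_iff_isComplex.2 hw),
    Measure.map_apply e.symm.continuous.measurable Metric.isClosed_closedBall.measurableSet,
    e.symm.preimage_closedBall, Complex.volume_closedBall]

instance archVol_sigmaFinite : SigmaFinite (archVol w) := by
  rw [archVol]
  split_ifs with h
  · exact (InfinitePlace.Completion.isometryEquivRealOfIsReal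
      h).symm.toHomeomorph.toMeasurableEquiv.sigmaFinite_map
  · exact (InfinitePlace.Completion.isometryEquivComplexOfIsComplex
      (InfinitePlace.not_isReal_iff_isComplex.mp h)).symm.toHomeomorph.toMeasurableEquiv.sigmaFinite_map

theorem descends_of_isComplex (hw : w.IsComplex) (E : Set (ℂ × ℂ)) :
    Descends w.Completion E := by
  intro m p t hp _ _ hpt
  have hsurj : Function.Surjective (algebraMap w.Completion ℂ) :=
    InfinitePlace.Completion.surjective_extensionEmbedding_of_isComplex hw
  have hlift : p ∈ lifts (algebraMap w.Completion ℂ) :=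
    (lifts_iff_coeff_lifts p).2 fun n => hsurj _
  obtain ⟨q, hq, hqd, hqm⟩ := lifts_and_natDegree_eq_and_monic hlift hp
  refine ⟨1, one_pos, q, hqm, by rw [hqd, mul_one], ?_⟩
  rw [hq, mul_one, pow_one]
  exact hpt.le

/-- The product of `p` and its complex conjugate has real coefficients, so `D = 2` works. -/
theorem descends_of_isReal (hw : w.IsReal) {E : Set (ℂ × ℂ)}
    (hE : GaloisStable w.Completion E) : Descends w.Completion E := by
  intro m p t hp hpm _ hpt
  have hreal : ∀ x : w.Completion, ∃ y : ℝ, algebraMap w.Completion ℂ x = y := fun x =>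
    ⟨_, (InfinitePlace.Completion.extensionEmbeddingOfIsReal_apply hw x).symm⟩
  let σ : ℂ ≃A[w.Completion] ℂ :=
    { toAlgEquiv := AlgEquiv.ofRingEquiv (f := starRingAut (R := ℂ)) fun x => by
        obtain ⟨y, hy⟩ := hreal x
        rw [hy]
        exact Complex.conj_ofReal y
      continuous_toFun := Complex.continuous_conj
      continuous_invFun := Complex.continuous_conj }
  have hσ : ∀ x, σ x = conj x := fun x => rfl
  have hσm := hE.formNorm_map_le σ (fun x => by rw [hσ]; exact Complex.norm_conj x) m p
  set p' := p.map (σ : ℂ →+* ℂ) with hp'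
  have hp'm : p'.Monic := hp.map _
  have hp'd : p'.natDegree = p.natDegree := natDegree_map _
  have hfix : (p * p').map (σ : ℂ →+* ℂ) = p * p' := by
    rw [Polynomial.map_mul, ← hp', mul_comm]
    congr 1
    rw [hp', Polynomial.map_map]
    ext i
    simp [hσ]
  have hlift : p * p' ∈ lifts (algebraMap w.Completion ℂ) := by
    refine (lifts_iff_coeff_lifts _).2 fun n => ?_
    have h1 : conj ((p * p').coeff n) = (p * p').coeff n := by
      conv_rhs => rw [← hfix, coeff_map]
      rfl
    obtain ⟨y, hy⟩ := Complex.conj_eq_iff_real.1 h1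
    obtain ⟨x, hx⟩ := InfinitePlace.Completion.surjective_extensionEmbeddingOfIsReal hw y
    refine ⟨x, ?_⟩
    rw [hy, ← hx]
    exact (InfinitePlace.Completion.extensionEmbeddingOfIsReal_apply hw x).symm
  obtain ⟨q, hq, hqd, hqm⟩ := lifts_and_natDegree_eq_and_monic hlift (hp.mul hp'm)
  refine ⟨2, two_pos, q, hqm, ?_, ?_⟩
  · rw [hqd, hp.natDegree_mul hp'm, hp'd, mul_two]
  · rw [hq, mul_two, sq]
    exact (formNorm_mul_le E hpm (hp'd.trans_le hpm)).trans
      (mul_le_mul' hpt.le (hσm.trans hpt.le))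

theorem arch_capacity {E : Set (ℂ × ℂ)} (hne : E.Nonempty) (hbdd : Bornology.IsBounded E)
    (hE : GaloisStable w.Completion E) :
    Tendsto (homDiameter (archAbs w) E) atTop (𝓝 (homTransfiniteDiameter (archAbs w) E)) ∧
      Tendsto (logVolume (archVol w) (archAbs w) E) atTop
        (𝓝 (-ENNReal.log (homSectionalCapacity (archVol w) (archAbs w) E))) ∧
      homTransfiniteDiameter (archAbs w) E ≠ ∞ ∧
      homSectionalCapacity (archVol w) (archAbs w) E = homTransfiniteDiameter (archAbs w) E := by
  have habs : archAbs w = fun z => ‖z‖ ^ w.mult := rfl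
  by_cases hw : w.IsReal
  · have hmult : w.mult = 1 := InfinitePlace.mult_isReal ⟨w, hw⟩
    have hvol : ∀ (x : w.Completion) (r : ℝ), archVol w (Metric.closedBall x r) =
        ENNReal.ofReal 2 * ENNReal.ofReal r ^ w.mult := by
      intro x r
      rw [archVol_closedBall_of_isReal w hw, hmult, pow_one, ENNReal.ofReal_mul two_pos.le]
    exact homSectionalCapacity_eq_of_descends (arch_norm_algebraMap w)
      (descends_of_isReal w hw hE) hne hbdd InfinitePlace.mult_ne_zero two_pos two_pos
      (fun x r _ => (hvol x r).le) (fun x r _ => (hvol x r).ge) habs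
  · rw [InfinitePlace.not_isReal_iff_isComplex] at hw
    have hmult : w.mult = 2 := InfinitePlace.mult_isComplex ⟨w, hw⟩
    have hvol : ∀ (x : w.Completion) (r : ℝ), archVol w (Metric.closedBall x r) =
        ENNReal.ofReal Real.pi * ENNReal.ofReal r ^ w.mult := by
      intro x r
      rw [archVol_closedBall_of_isComplex w hw, hmult, mul_comm]
      congr 1
      rw [← NNReal.coe_real_pi, ENNReal.ofReal_coe_nnreal]
    exact homSectionalCapacity_eq_of_descends (arch_norm_algebraMap w)
      (descends_of_isComplex w hw E) hne hbdd InfinitePlace.mult_ne_zero Real.pi_pos Real.pi_pos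
      (fun x r _ => (hvol x r).le) (fun x r _ => (hvol x r).ge) habs

end Archimedean

/-! ### Nonarchimedean places: descent by approximation and Galois norms -/

section Adic

open Polynomial

variable {k : Type*} [Field k] [NumberField k] (v : HeightOneSpectrum (𝓞 k))

theorem adic_norm_algebraMap (x : v.adicCompletion k) :
    ‖algebraMap (v.adicCompletion k) (AdicComplex v) x‖ = ‖x‖ := by
  rw [norm_algebraMap']

instance adicAlgCl_isGalois : IsGalois (v.adicCompletion k) (AdicAlgCl v) := by
  have : CharZero (v.adicCompletion k) :=
    charZero_of_injective_algebraMap (algebraMap k (v.adicCompletion k)).injective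
  infer_instance

theorem adic_norm_algEquiv (σ : AdicAlgCl v ≃ₐ[v.adicCompletion k] AdicAlgCl v)
    (x : AdicAlgCl v) : ‖σ x‖ = ‖x‖ :=
  (spectralNorm_eq_of_equiv σ x).symm

theorem adic_continuous_algEquiv (σ : AdicAlgCl v ≃ₐ[v.adicCompletion k] AdicAlgCl v) :
    Continuous σ :=
  (AddMonoidHomClass.isometry_of_norm σ (adic_norm_algEquiv v σ)).continuous

/-- The spectral norm is Galois invariant, so `σ` is an isometry and extends by continuity to the
completion. -/
theorem adic_exists_extension (σ : AdicAlgCl v ≃ₐ[v.adicCompletion k] AdicAlgCl v) :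
    ∃ τ : AdicComplex v ≃A[v.adicCompletion k] AdicComplex v,
      (∀ x : AdicAlgCl v, τ (x : AdicComplex v) = (σ x : AdicComplex v)) ∧
      ∀ x, ‖τ x‖ = ‖x‖ := by
  have hc := adic_continuous_algEquiv v σ
  have hc' := adic_continuous_algEquiv v σ.symm
  have hcoe : ∀ x : AdicAlgCl v, UniformSpace.Completion.mapRingEquiv
      (σ : AdicAlgCl v ≃+* AdicAlgCl v) hc hc' (x : AdicComplex v) = (σ x : AdicComplex v) := fun x => by
    exact UniformSpace.Completion.mapRingHom_coe (f := (σ : AdicAlgCl v →+* AdicAlgCl v)) hc x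
  let τ : AdicComplex v ≃A[v.adicCompletion k] AdicComplex v :=
    { toAlgEquiv := AlgEquiv.ofRingEquiv
        (f := UniformSpace.Completion.mapRingEquiv (σ : AdicAlgCl v ≃+* AdicAlgCl v) hc hc')
        fun x => by
          rw [UniformSpace.Completion.algebraMap_def, hcoe, σ.commutes]
      continuous_toFun := UniformSpace.Completion.continuous_map
      continuous_invFun := UniformSpace.Completion.continuous_map }
  refine ⟨τ, hcoe, fun x => ?_⟩
  refine UniformSpace.Completion.induction_on x
    (isClosed_eq (τ.continuous_toFun.norm) continuous_norm) fun x => ?_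
  have : τ (x : AdicComplex v) = (σ x : AdicComplex v) := hcoe x
  rw [this, UniformSpace.Completion.norm_coe, UniformSpace.Completion.norm_coe,
    adic_norm_algEquiv]

theorem formNorm_prod_le {C ι : Type*} [NormedField C] (E : Set (C × C)) (s : Finset ι) {n : ℕ}
    {p : ι → C[X]} (hp : ∀ i ∈ s, (p i).natDegree ≤ n) :
    formNorm E (n * s.card) (∏ i ∈ s, p i) ≤ ∏ i ∈ s, formNorm E n (p i) := by
  classical
  induction s using Finset.induction_on with
  | empty => simpa using formNorm_one_le E
  | insert a s ha ih =>
    rw [Finset.prod_insert ha, Finset.prod_insert ha, Finset.card_insert_of_notMem ha,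
      Nat.mul_succ, add_comm]
    have hs : ∀ i ∈ s, (p i).natDegree ≤ n := fun i hi => hp i (Finset.mem_insert_of_mem hi)
    refine (formNorm_mul_le E (hp a (Finset.mem_insert_self a s)) ?_).trans
      (mul_le_mul_right (ih hs) _)
    refine (natDegree_prod_le s p).trans ?_
    rw [mul_comm]
    exact Finset.sum_le_card_nsmul _ _ _ hs

/-- The inclusion of the algebraic closure of `k_v` into `ℂ_v`. -/
abbrev adicIncl : AdicAlgCl v →+* AdicComplex v := UniformSpace.Completion.coeRingHom

/-- Coefficients in `ℂ_v` need not be algebraic. On a bounded set the norm depends continuously on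
them, so a strict bound survives a small change of the lower coefficients to algebraic ones, with
the leading `1` kept. -/
theorem adic_exists_approx {E : Set (AdicComplex v × AdicComplex v)} {R : ℝ≥0∞}
    (hE : ∀ z ∈ E, ‖z.1‖ₑ ≤ R ∧ ‖z.2‖ₑ ≤ R) (hR : R ≠ ∞) {m : ℕ} {p : (AdicComplex v)[X]}
    (hp : p.Monic) {t : ℝ≥0∞} (hpt : formNorm E m p < t) :
    ∃ q : (AdicAlgCl v)[X], q.Monic ∧ q.natDegree = p.natDegree ∧
      formNorm E m (q.map (adicIncl v)) < t := by
  -- A form with `m + 1` coefficients of size at most `ε` has norm at most `ε * ((m + 1) * R ^ m)`,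
  -- which is made smaller than the slack `t - formNorm E m p`.
  obtain ⟨ε, hε, hεt⟩ := ENNReal.exists_nnreal_pos_mul_lt (a := (m + 1) * R ^ m)
    (b := t - formNorm E m p) (ENNReal.mul_ne_top (by simp) (by simp [hR]))
    (tsub_pos_of_lt hpt).ne'
  have hex : ∀ x : AdicComplex v, ∃ y : AdicAlgCl v, ‖(y : AdicComplex v) - x‖ₑ ≤ ε := by
    intro x
    obtain ⟨y, hy⟩ := UniformSpace.Completion.denseRange_coe.exists_dist_lt x
      (NNReal.coe_pos.2 hε)
    refine ⟨y, ?_⟩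
    rw [dist_comm, dist_eq_norm] at hy
    rw [← ofReal_norm, ← ENNReal.ofReal_coe_nnreal]
    exact ENNReal.ofReal_le_ofReal hy.le
  choose y hy using hex
  set d := p.natDegree with hd
  set q : (AdicAlgCl v)[X] := X ^ d + ∑ i : Fin d, C (y (p.coeff i)) * X ^ (i : ℕ) with hq
  have hlow : (∑ i : Fin d, C (y (p.coeff i)) * X ^ (i : ℕ) : (AdicAlgCl v)[X]).degree < d := by
    refine (degree_sum_le _ _).trans_lt ((Finset.sup_lt_iff (WithBot.bot_lt_coe d)).2 fun i _ => ?_)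
    exact (degree_C_mul_X_pow_le _ _).trans_lt (WithBot.coe_lt_coe.2 i.2)
  have hqm : q.Monic := monic_X_pow_add hlow
  have hqd : q.natDegree = d := by
    rw [hq, natDegree_add_eq_left_of_degree_lt (by rwa [degree_X_pow]), natDegree_X_pow]
  refine ⟨q, hqm, hqd, ?_⟩
  have hcoeff : ∀ i : ℕ, ‖(q.map (adicIncl v) - p).coeff i‖ₑ ≤ ε := by
    intro i
    rw [coeff_sub, coeff_map]
    rcases lt_trichotomy i d with hi | hi | hi
    · have : q.coeff i = y (p.coeff i) := by
        rw [hq, coeff_add, coeff_X_pow, if_neg hi.ne, zero_add, finsetSum_coeff,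
          Finset.sum_eq_single ⟨i, hi⟩]
        · simp
        · intro j _ hj
          rw [coeff_C_mul_X_pow, if_neg fun h => hj (Fin.ext h.symm)]
        · simp
      rw [this]
      exact hy _
    · have h1 : q.coeff i = 1 := by rw [hi, ← hqd]; exact hqm.coeff_natDegree
      have h2 : p.coeff i = 1 := by rw [hi, hd]; exact hp.coeff_natDegree
      rw [h1, h2, map_one, sub_self]
      simp
    · rw [coeff_eq_zero_of_natDegree_lt (hqd.trans_lt hi), coeff_eq_zero_of_natDegree_lt hi,
        map_zero, sub_self]
      simp
  have h1 : formNorm E m (q.map (adicIncl v)) ≤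
      formNorm E m p + formNorm E m (q.map (adicIncl v) - p) := by
    simpa using formNorm_add_le E m p (q.map (adicIncl v) - p)
  have h2 : formNorm E m (q.map (adicIncl v) - p) ≤ ε * ((m + 1) * R ^ m) := by
    refine (formNorm_le_sum_coeff hE m _).trans ?_
    rw [← mul_assoc]
    gcongr
    refine (Finset.sum_le_card_nsmul Finset.univ
      (fun i : Fin (m + 1) => ‖(q.map (adicIncl v) - p).coeff i‖ₑ) _
      fun i _ => hcoeff i).trans_eq ?_
    simp [mul_comm]
  refine (h1.trans (add_le_add_right h2 _)).trans_lt ?_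
  rw [add_comm]
  exact lt_tsub_iff_right.1 hεt

/-- After approximation the coefficients lie in a finite Galois extension `L`. The product of the
conjugates over `Gal(L/k_v)` has coefficients in `k_v`, and each conjugate comes from an isometry of
`ℂ_v`, so it obeys the same bound; `D` is the order of the group. -/
theorem adic_descends {E : Set (AdicComplex v × AdicComplex v)}
    (hbdd : Bornology.IsBounded E) (hE : GaloisStable (v.adicCompletion k) E) :
    Descends (v.adicCompletion k) E := by
  intro m p t hp hpm _ hpt
  obtain ⟨R, hR, hER⟩ := hbdd.exists_pos_norm_le
  have hER' : ∀ z ∈ E, ‖z.1‖ₑ ≤ ENNReal.ofReal R ∧ ‖z.2‖ₑ ≤ ENNReal.ofReal R := fun z hz => by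
    rw [← ofReal_norm, ← ofReal_norm]
    exact ⟨ENNReal.ofReal_le_ofReal ((norm_fst_le z).trans (hER z hz)),
      ENNReal.ofReal_le_ofReal ((norm_snd_le z).trans (hER z hz))⟩
  obtain ⟨p₁, hp₁m, hp₁d, hp₁t⟩ := adic_exists_approx v hER' ENNReal.ofReal_ne_top hp hpt
  let L := FiniteGaloisIntermediateField.adjoin (v.adicCompletion k)
    (p₁.coeffs : Set (AdicAlgCl v))
  have hlift : p₁ ∈ lifts (algebraMap L (AdicAlgCl v)) := by
    refine (lifts_iff_coeff_lifts p₁).2 fun n => ?_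
    by_cases h : p₁.coeff n = 0
    · exact ⟨0, by rw [h, map_zero]⟩
    · exact ⟨⟨p₁.coeff n, FiniteGaloisIntermediateField.subset_adjoin _ _
        (coeff_mem_coeffs h)⟩, rfl⟩
  obtain ⟨p₂, hp₂, hp₂d, hp₂m⟩ := lifts_and_natDegree_eq_and_monic hlift hp₁m
  set q₂ : L[X] := ∏ σ : L ≃ₐ[v.adicCompletion k] L, p₂.map (σ : L →+* L) with hq₂
  have hfix : ∀ τ : L ≃ₐ[v.adicCompletion k] L, q₂.map (τ : L →+* L) = q₂ := by
    intro τ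
    rw [hq₂, Polynomial.map_prod]
    refine Fintype.prod_equiv (Equiv.mulLeft τ) _ _ fun σ => ?_
    rw [Polynomial.map_map]
    rfl
  have hq₂m : q₂.Monic := monic_prod_of_monic _ _ fun σ _ => hp₂m.map _
  have hlift₂ : q₂ ∈ lifts (algebraMap (v.adicCompletion k) L) := by
    refine (lifts_iff_coeff_lifts q₂).2 fun n => ?_
    refine (IsGalois.mem_range_algebraMap_iff_fixed _).2 fun τ => ?_
    conv_rhs => rw [← hfix τ, coeff_map]
    rfl
  obtain ⟨q, hq, hqd, hqm⟩ := lifts_and_natDegree_eq_and_monic hlift₂ hq₂m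
  refine ⟨Fintype.card (L ≃ₐ[v.adicCompletion k] L), Fintype.card_pos, q, hqm, ?_, ?_⟩
  · rw [hqd, hq₂, natDegree_prod_of_monic _ _ fun σ _ => hp₂m.map _]
    simp [natDegree_map, hp₂d, hp₁d, mul_comm]
  · have hmap : q.map (algebraMap (v.adicCompletion k) (AdicComplex v)) =
        ∏ σ : L ≃ₐ[v.adicCompletion k] L,
          (p₂.map (σ : L →+* L)).map ((adicIncl v).comp (algebraMap L (AdicAlgCl v))) := by
      rw [← Polynomial.map_prod, ← hq₂, ← hq, Polynomial.map_map]
      rfl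
    rw [hmap]
    refine (formNorm_prod_le E Finset.univ fun σ _ => ?_).trans ?_
    · rw [natDegree_map, natDegree_map, hp₂d, hp₁d]
      exact hpm
    · refine (Finset.prod_le_pow_card _ _ _ fun σ _ => ?_).trans_eq (by rw [Finset.card_univ])
      obtain ⟨τ, hτ, hτn⟩ := adic_exists_extension v (σ.liftNormal (AdicAlgCl v))
      have : (p₂.map (σ : L →+* L)).map ((adicIncl v).comp (algebraMap L (AdicAlgCl v))) =
          (p₁.map (adicIncl v)).map (τ : AdicComplex v →+* AdicComplex v) := by
        rw [← hp₂, Polynomial.map_map, Polynomial.map_map, Polynomial.map_map]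
        congr 1
        ext x
        simp only [RingHom.comp_apply]
        have h1 := hτ (algebraMap L (AdicAlgCl v) x)
        rw [AlgEquiv.liftNormal_commutes] at h1
        exact h1.symm
      rw [this]
      exact (hE.formNorm_map_le τ hτn m _).trans hp₁t.le

end Adic

/-! ### Haar volume of balls in `k_v` -/

section AdicVolume

variable {k : Type*} [Field k] [NumberField k] (v : HeightOneSpectrum (𝓞 k))

theorem one_lt_absNorm_real : (1 : ℝ) < Ideal.absNorm v.asIdeal := by
  exact_mod_cast NumberField.HeightOneSpectrum.one_lt_absNorm v

theorem adic_norm_eq_zpow {x : v.adicCompletion k} (hx : x ≠ 0) :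
    ∃ n : ℤ, ‖x‖ = (Ideal.absNorm v.asIdeal : ℝ) ^ n := by
  have h : Valued.v x ≠ 0 := (Valuation.ne_zero_iff _).2 hx
  refine ⟨(WithZero.unzero h).toAdd, ?_⟩
  rw [FinitePlace.norm_def, WithZeroMulInt.toNNReal_neg_apply _ h]
  push_cast
  rfl

theorem adic_exists_norm_eq_zpow (n : ℤ) :
    ∃ x : v.adicCompletion k, ‖x‖ = (Ideal.absNorm v.asIdeal : ℝ) ^ n := by
  obtain ⟨x, hx⟩ := v.valuedAdicCompletion_surjective k (WithZero.exp n)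
  refine ⟨x, ?_⟩
  rw [FinitePlace.norm_def, hx, WithZeroMulInt.toNNReal_neg_apply _ WithZero.exp_ne_zero]
  push_cast
  rfl

theorem adic_norm_le_of_lt {x : v.adicCompletion k} {n : ℤ}
    (hx : ‖x‖ < (Ideal.absNorm v.asIdeal : ℝ) ^ n) :
    ‖x‖ ≤ (Ideal.absNorm v.asIdeal : ℝ) ^ (n - 1) := by
  have h1 := one_lt_absNorm_real v
  rcases eq_or_ne x 0 with rfl | h0
  · rw [norm_zero]
    positivity
  obtain ⟨j, hj⟩ := adic_norm_eq_zpow v h0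
  rw [hj] at hx ⊢
  have := (zpow_lt_zpow_iff_right₀ h1).1 hx
  exact zpow_le_zpow_right₀ h1.le (by omega)

theorem adic_norm_ringOfIntegers_lt_one_iff (r : 𝓞 k) :
    ‖algebraMap k (v.adicCompletion k) r‖ < 1 ↔ r ∈ v.asIdeal :=
  FinitePlace.norm_lt_one_iff_mem k v r

theorem adic_norm_sub_le_max (x y : v.adicCompletion k) : ‖x - y‖ ≤ max ‖x‖ ‖y‖ := by
  simpa [sub_eq_add_neg] using IsUltrametricDist.norm_add_le_max x (-y)

theorem adic_exists_ringOfIntegers {x : v.adicCompletion k} (hx : ‖x‖ ≤ 1) :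
    ∃ r : 𝓞 k, ‖x - algebraMap k (v.adicCompletion k) r‖ < 1 := by
  obtain ⟨c, hc⟩ := (v.denseRange_algebraMap k).exists_dist_lt x one_pos
  rw [dist_eq_norm] at hc
  have hc1 : ‖algebraMap k (v.adicCompletion k) c‖ ≤ 1 := by
    have := adic_norm_sub_le_max v x (x - algebraMap k (v.adicCompletion k) c)
    rw [sub_sub_cancel] at this
    exact this.trans (max_le hx hc.le)
  have hc2 : v.valuation k c ≤ 1 := by
    rw [← v.valuedAdicCompletion_eq_valuation' (K := k) c]
    exact Valued.toNormedField.norm_le_one_iff.1 hc1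
  obtain ⟨r, hr⟩ := v.exists_valuation_sub_lt_of_integer (K := k) hc2 1
  refine ⟨r, ?_⟩
  have hr' : ‖algebraMap k (v.adicCompletion k) (algebraMap (𝓞 k) k r - c)‖ < 1 := by
    refine Valued.toNormedField.norm_lt_one_iff.2 ?_
    rw [Units.val_one, ← v.valuedAdicCompletion_eq_valuation' (K := k)] at hr
    exact hr
  have h := adic_norm_sub_le_max v (x - algebraMap k (v.adicCompletion k) c)
    (algebraMap k (v.adicCompletion k) (algebraMap (𝓞 k) k r - c))
  rw [map_sub, sub_sub_sub_cancel_right] at h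
  rw [map_sub] at hr'
  exact h.trans_lt (max_lt hc hr')

instance adicVol_isAddHaarMeasure : (adicVol v).IsAddHaarMeasure :=
  inferInstanceAs (Measure.addHaarMeasure _).IsAddHaarMeasure

theorem adicVol_closedBall_center (x : v.adicCompletion k) (r : ℝ) :
    adicVol v (Metric.closedBall x r) = adicVol v (Metric.closedBall 0 r) := by
  rw [← measure_preimage_add (adicVol v) x (Metric.closedBall x r)]
  congr 1
  ext y
  simp [dist_eq_norm]

theorem adicVol_closedBall_one : adicVol v (Metric.closedBall 0 1) = 1 :=
  Measure.addHaarMeasure_self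

/-- With `q = Ideal.absNorm v.asIdeal` and `|a| = q ^ n`, the ball is the disjoint union of the `q`
balls of radius `q ^ (n-1)` about `a * s`, for `s` running over representatives of `𝓞 k / v`;
translation invariance makes their volumes equal. -/
theorem adicVol_closedBall_zpow_eq_mul (n : ℤ) :
    adicVol v (Metric.closedBall 0 ((Ideal.absNorm v.asIdeal : ℝ) ^ n)) =
      Ideal.absNorm v.asIdeal *
        adicVol v (Metric.closedBall 0 ((Ideal.absNorm v.asIdeal : ℝ) ^ (n - 1))) := by
  have h1 := one_lt_absNorm_real v
  have h0 : (0 : ℝ) < Ideal.absNorm v.asIdeal := by linarith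
  obtain ⟨a, ha⟩ := adic_exists_norm_eq_zpow v n
  have hapos : 0 < ‖a‖ := by rw [ha]; positivity
  have ha0 : a ≠ 0 := norm_pos_iff.1 hapos
  have : Finite (𝓞 k ⧸ v.asIdeal) := v.asIdeal.finiteQuotientOfFreeOfNeBot v.ne_bot
  have := Fintype.ofFinite (𝓞 k ⧸ v.asIdeal)
  set c : 𝓞 k ⧸ v.asIdeal → v.adicCompletion k := fun s =>
    a * algebraMap k (v.adicCompletion k) (Quotient.out s : 𝓞 k) with hc
  have hdist : ∀ r s : 𝓞 k, ‖a * algebraMap k (v.adicCompletion k) r -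
      a * algebraMap k (v.adicCompletion k) s‖ < ‖a‖ ↔
        (Ideal.Quotient.mk v.asIdeal r) = Ideal.Quotient.mk v.asIdeal s := by
    intro r s
    rw [Ideal.Quotient.eq, ← adic_norm_ringOfIntegers_lt_one_iff, ← mul_sub, norm_mul,
      mul_lt_iff_lt_one_right hapos]
    simp
  have hout : ∀ s : 𝓞 k ⧸ v.asIdeal,
      Ideal.Quotient.mk v.asIdeal (Quotient.out s : 𝓞 k) = s := fun s => Quotient.out_eq s
  have hlt : (Ideal.absNorm v.asIdeal : ℝ) ^ (n - 1) < ‖a‖ := by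
    rw [ha]
    exact zpow_lt_zpow_right₀ h1 (by omega)
  have hunion : Metric.closedBall (0 : v.adicCompletion k) ((Ideal.absNorm v.asIdeal : ℝ) ^ n) =
      ⋃ s, Metric.closedBall (c s) ((Ideal.absNorm v.asIdeal : ℝ) ^ (n - 1)) := by
    ext x
    simp only [Set.mem_iUnion, mem_closedBall_iff_norm, sub_zero]
    constructor
    · intro hx
      have hx' : ‖a⁻¹ * x‖ ≤ 1 := by
        rw [norm_mul, norm_inv, inv_mul_le_one₀ hapos, ha]
        exact hx
      obtain ⟨r, hr⟩ := adic_exists_ringOfIntegers v hx'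
      refine ⟨Ideal.Quotient.mk v.asIdeal r, adic_norm_le_of_lt v ?_⟩
      have e1 : ‖x - a * algebraMap k (v.adicCompletion k) r‖ < ‖a‖ := by
        have : x - a * algebraMap k (v.adicCompletion k) r =
            a * (a⁻¹ * x - algebraMap k (v.adicCompletion k) r) := by
          field_simp
        rw [this, norm_mul, mul_lt_iff_lt_one_right hapos]
        exact hr
      have e2 := (hdist r (Quotient.out (Ideal.Quotient.mk v.asIdeal r) : 𝓞 k)).2 (hout _).symm
      rw [← ha]
      have h := IsUltrametricDist.norm_add_le_max (x - a * algebraMap k (v.adicCompletion k) r)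
        (a * algebraMap k (v.adicCompletion k) r - c (Ideal.Quotient.mk v.asIdeal r))
      rw [sub_add_sub_cancel] at h
      exact h.trans_lt (max_lt e1 e2)
    · rintro ⟨s, hs⟩
      have e1 : ‖c s‖ ≤ ‖a‖ := by
        rw [hc, norm_mul]
        exact mul_le_of_le_one_right hapos.le (FinitePlace.norm_le_one k v _)
      have h := IsUltrametricDist.norm_add_le_max (x - c s) (c s)
      rw [sub_add_cancel] at h
      rw [← ha]
      exact h.trans (max_le (hs.trans hlt.le) e1)
  have hdisj : Pairwise (Function.onFun Disjoint fun s =>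
      Metric.closedBall (c s) ((Ideal.absNorm v.asIdeal : ℝ) ^ (n - 1))) := by
    intro s t hst
    refine Set.disjoint_left.2 fun x hxs hxt => hst ?_
    rw [mem_closedBall_iff_norm] at hxs hxt
    rw [← hout s, ← hout t, ← hdist]
    have h := adic_norm_sub_le_max v (x - c t) (x - c s)
    rw [sub_sub_sub_cancel_left] at h
    exact (h.trans (max_le hxt hxs)).trans_lt hlt
  rw [hunion, measure_iUnion hdisj fun s => Metric.isClosed_closedBall.measurableSet, tsum_fintype]
  simp_rw [adicVol_closedBall_center v (c _)]
  rw [Finset.sum_const, Finset.card_univ, nsmul_eq_mul, Ideal.absNorm_apply,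
    Submodule.cardQuot_apply, Nat.card_eq_fintype_card]

theorem adicVol_closedBall_zpow (n : ℤ) :
    adicVol v (Metric.closedBall 0 ((Ideal.absNorm v.asIdeal : ℝ) ^ n)) =
      ENNReal.ofReal ((Ideal.absNorm v.asIdeal : ℝ) ^ n) := by
  have h1 := one_lt_absNorm_real v
  have h0 : (0 : ℝ) < Ideal.absNorm v.asIdeal := by linarith
  have hmul : ∀ j : ℤ, ENNReal.ofReal ((Ideal.absNorm v.asIdeal : ℝ) ^ j) =
      Ideal.absNorm v.asIdeal * ENNReal.ofReal ((Ideal.absNorm v.asIdeal : ℝ) ^ (j - 1)) := by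
    intro j
    rw [← ENNReal.ofReal_natCast, ← ENNReal.ofReal_mul h0.le, ← zpow_one_add₀ h0.ne',
      add_sub_cancel]
  induction n using Int.induction_on with
  | zero => simpa using adicVol_closedBall_one v
  | succ j ih => rw [adicVol_closedBall_zpow_eq_mul, hmul, add_sub_cancel_right, ih]
  | pred j ih =>
    rw [adicVol_closedBall_zpow_eq_mul, hmul] at ih
    exact (ENNReal.mul_right_inj (by simpa using h0.ne') (ENNReal.natCast_ne_top _)).1 ih

/-- A radius in `[q ^ n, q ^ (n+1))` is compared with its endpoints. The loss of a factor `q` is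
harmless: over `n + 1` coordinates it adds only `O(n)` to the logarithm of the volume. -/
theorem adicVol_closedBall_bounds (x : v.adicCompletion k) {r : ℝ} (hr : 0 < r) :
    ENNReal.ofReal (1 / Ideal.absNorm v.asIdeal) * ENNReal.ofReal r ≤
        adicVol v (Metric.closedBall x r) ∧
      adicVol v (Metric.closedBall x r) ≤
        ENNReal.ofReal (Ideal.absNorm v.asIdeal) * ENNReal.ofReal r := by
  have h1 := one_lt_absNorm_real v
  have h0 : (0 : ℝ) < Ideal.absNorm v.asIdeal := by linarith
  obtain ⟨n, hn, hn'⟩ := exists_mem_Ico_zpow hr h1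
  have hz : (Ideal.absNorm v.asIdeal : ℝ) ^ (n + 1) =
      Ideal.absNorm v.asIdeal * (Ideal.absNorm v.asIdeal : ℝ) ^ n := by
    rw [zpow_add_one₀ h0.ne', mul_comm]
  rw [adicVol_closedBall_center, ← ENNReal.ofReal_mul (by positivity),
    ← ENNReal.ofReal_mul h0.le]
  constructor
  · refine le_trans ?_ (measure_mono (Metric.closedBall_subset_closedBall hn))
    rw [adicVol_closedBall_zpow]
    refine ENNReal.ofReal_le_ofReal ?_
    rw [one_div, inv_mul_le_iff₀ h0, ← hz]
    exact hn'.le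
  · refine (measure_mono (Metric.closedBall_subset_closedBall hn'.le)).trans ?_
    rw [adicVol_closedBall_zpow, hz]
    exact ENNReal.ofReal_le_ofReal (mul_le_mul_of_nonneg_left hn h0.le)

theorem adic_capacity {E : Set (AdicComplex v × AdicComplex v)} (hne : E.Nonempty)
    (hbdd : Bornology.IsBounded E) (hE : GaloisStable (v.adicCompletion k) E) :
    Tendsto (homDiameter (adicAbs v) E) atTop (𝓝 (homTransfiniteDiameter (adicAbs v) E)) ∧
      Tendsto (logVolume (adicVol v) (adicAbs v) E) atTop
        (𝓝 (-ENNReal.log (homSectionalCapacity (adicVol v) (adicAbs v) E))) ∧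
      homTransfiniteDiameter (adicAbs v) E ≠ ∞ ∧
      homSectionalCapacity (adicVol v) (adicAbs v) E = homTransfiniteDiameter (adicAbs v) E := by
  have h1 := one_lt_absNorm_real v
  have h0 : (0 : ℝ) < Ideal.absNorm v.asIdeal := by linarith
  refine homSectionalCapacity_eq_of_descends (adic_norm_algebraMap v) (adic_descends v hbdd hE)
    -- Here `δ = 1`, since the norm on `ℂ_v` is already the normalized absolute value.
    hne hbdd one_ne_zero h0 (one_div_pos.2 h0) (fun x r hr => ?_) (fun x r hr => ?_) ?_
  · rw [pow_one]
    exact (adicVol_closedBall_bounds v x hr).2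
  · rw [pow_one]
    exact (adicVol_closedBall_bounds v x hr).1
  · funext z
    simp [adicAbs]

end AdicVolume

end

end HomCap

theorem mainTheorem11 {k : Type*} [Field k] [NumberField k] :
    (∀ (w : InfinitePlace k) (E : Set (ℂ × ℂ)), E.Nonempty → Bornology.IsBounded E →
      HomCap.GaloisStable w.Completion E →
        Tendsto (HomCap.homDiameter (HomCap.archAbs w) E) atTop
          (𝓝 (HomCap.homTransfiniteDiameter (HomCap.archAbs w) E)) ∧
        Tendsto (HomCap.logVolume (HomCap.archVol w) (HomCap.archAbs w) E) atTop
          (𝓝 (-ENNReal.log (HomCap.homSectionalCapacity (HomCap.archVol w)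
            (HomCap.archAbs w) E))) ∧
        HomCap.homTransfiniteDiameter (HomCap.archAbs w) E ≠ ∞ ∧
        HomCap.homSectionalCapacity (HomCap.archVol w) (HomCap.archAbs w) E =
          HomCap.homTransfiniteDiameter (HomCap.archAbs w) E) ∧
    (∀ (v : HeightOneSpectrum (𝓞 k)) (E : Set (HomCap.AdicComplex v × HomCap.AdicComplex v)),
      E.Nonempty → Bornology.IsBounded E →
      HomCap.GaloisStable (v.adicCompletion k) E →
        Tendsto (HomCap.homDiameter (HomCap.adicAbs v) E) atTop
          (𝓝 (HomCap.homTransfiniteDiameter (HomCap.adicAbs v) E)) ∧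
        Tendsto (HomCap.logVolume (HomCap.adicVol v) (HomCap.adicAbs v) E) atTop
          (𝓝 (-ENNReal.log (HomCap.homSectionalCapacity (HomCap.adicVol v)
            (HomCap.adicAbs v) E))) ∧
        HomCap.homTransfiniteDiameter (HomCap.adicAbs v) E ≠ ∞ ∧
        HomCap.homSectionalCapacity (HomCap.adicVol v) (HomCap.adicAbs v) E =
          HomCap.homTransfiniteDiameter (HomCap.adicAbs v) E) :=
  ⟨fun w _ hne hbdd hE => HomCap.arch_capacity w hne hbdd hE,
    fun v _ hne hbdd hE => HomCap.adic_capacity v hne hbdd hE⟩
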